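/- Let $n\ge 1$, $\alpha>0$ and $1<p<n/\alpha$. For nonnegative quantities write $X\prec Y$ if $X\le cY$ with a finite constant $c$, and $X\approx Y$ if $X\prec Y$ and $Y\prec X$. Let $K_\nu$ be the modified Bessel function of the third kind, let $G_\alpha(x)=|x|^{(\alpha-n)/2}K_{(n-\alpha)/2}(|x|)$ be the Bessel kernel on $\mathbb R^n$, and let $H^\alpha_p$ be the space of all $f=G_\alpha * g$ with $g\in L^p(\mathbb R^n)$, normed by $\|f\|_{H^\alpha_p}=\|g\|_{L^p}$. For an open set $O\subset\mathbb R^n$ let $$\mathrm{cap}(O;H^\alpha_p)=\inf\{\|f\|^p_{H^\alpha_p}: f\in\mathcal S(\mathbb R^n),\ f\ge 0,\ f\ge 1\text{ on }O\}\in[0,\infty]$$ ($\mathcal S$ is the Schwartz class; $\inf\emptyset=\infty$), and let $TO=\{(x,t)\in\mathbb R^n\times(0,\infty): x\in O,\ t<\mathrm{dist}(x,\partial O)\}$ be the tent over $O$ (with $\mathrm{dist}(x,\emptyset)=\infty$). For a function $\Phi:[0,\infty)\to[0,\infty)$, extended by $\Phi(\infty)=\infty$, let $Cap^\Phi(H^\alpha_p)$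 be the class of positive Borel measures $\mu$ on $\mathbb R^n\times(0,\infty)$ with $\mu(TO)\prec\Phi(\mathrm{cap}(O;H^\alpha_p))$ uniformly for all open sets $O\subset\mathbb R^n$, and let $C^\Phi$ be the class of those with $\mu(TB_r)\prec\Phi(r)$ uniformly for all balls $B_r\subset\mathbb R^n$ of radius $r>0$. **Theorem.** Let $\Psi$ be a function from $[0,\infty)$ onto $[0,\infty)$ such that $\Psi\approx\widetilde\Psi$ for some strictly increasing $\widetilde\Psi:[0,\infty)\to[0,\infty)$, such that $\Psi(0)=0$, such that for every $c>0$, $\Psi(cs)\approx\Psi(s)$ for all $s\ge0$ (with constants that may depend on $c$), and such that $$\int_0^s\left(\frac{\Psi(u)}{u}\right)^{1/p}\frac{du}{u}\prec\left(\frac{\Psi(s)}{s}\right)^{1/p}\quad\text{uniformly for all } s>0 .$$ Set $\Psi^\alpha(s)=\Psi(s^{n-\alpha p})$ for $0\le s<1$ and $\Psi^\alpha(s)=\Psi(s^n)$ for $s\ge1$. Then $$Cap^\Psi(H^\alpha_p)=C^{\Psi^\alpha}.$$ -/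

import Mathlib

open MeasureTheory
open scoped NNReal ENNReal

noncomputable section

/-- Two functions on `[0, ∞)` are equivalent, `Φ ≈ Ψ`, if each is bounded by a constant multiple
of the other. -/
def FunEquiv (Φ Ψ : ℝ≥0 → ℝ≥0) : Prop :=
  ∃ C : ℝ≥0, ∀ s, Φ s ≤ C * Ψ s ∧ Ψ s ≤ C * Φ s

/-- The extension of `Φ` to `[0, ∞]` by `Φ(∞) = ∞`. (A capacity may be infinite.) -/
def extendTop (Φ : ℝ≥0 → ℝ≥0) (x : ℝ≥0∞) : ℝ≥0∞ :=
  if x = ⊤ then ⊤ else (Φ x.toNNReal : ℝ≥0∞)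

/-- The upper half-space `ℝⁿ × (0, ∞)`. -/
abbrev HalfSpace (n : ℕ) : Type := EuclideanSpace ℝ (Fin n) × Set.Ioi (0 : ℝ)

/-- The tent `TO = {(x, t) : x ∈ O, t < dist(x, ∂O)}` over a set `O ⊆ ℝⁿ`. The distance to the
empty set is `∞`, so that the tent over `ℝⁿ` is the whole upper half-space. -/
def tent {n : ℕ} (O : Set (EuclideanSpace ℝ (Fin n))) : Set (HalfSpace n) :=
  {z | z.1 ∈ O ∧ ENNReal.ofReal (z.2 : ℝ) < Metric.infEDist z.1 (frontier O)}

/-- The modified Bessel function `K_ν(r)` of the third kind, for `r > 0` and `ν > -1/2`. -/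
def besselK (ν r : ℝ) : ℝ :=
  √(Real.pi / 2) / Real.Gamma (ν + 1 / 2) * r ^ (-(1 / 2) : ℝ) * Real.exp (-r) *
    ∫ u in Set.Ioi (0 : ℝ),
      Real.exp (-u) * u ^ (ν - 1 / 2) * (1 + u / (2 * r)) ^ (ν - 1 / 2)

/-- The Bessel kernel `G_α(x) = |x|^{(α - n)/2} K_{(n - α)/2}(|x|)` on `ℝⁿ`. -/
def besselKernel (n : ℕ) (α : ℝ) (x : EuclideanSpace ℝ (Fin n)) : ℝ :=
  ‖x‖ ^ ((α - n) / 2) * besselK ((n - α) / 2) ‖x‖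

/-- `f = G_α * g` almost everywhere, with `g ∈ L^p(ℝⁿ)`. -/
def IsBesselPotential {n : ℕ} (α p : ℝ) (f g : EuclideanSpace ℝ (Fin n) → ℝ) : Prop :=
  MemLp g (ENNReal.ofReal p) volume ∧
    f =ᵐ[volume] convolution (besselKernel n α) g (ContinuousLinearMap.mul ℝ ℝ) volume

/-- The norm of `H^α_p`: `‖f‖ = ‖g‖_{L^p}` if `f = G_α * g` with `g ∈ L^p`, and `∞` if `f` is not
in `H^α_p`. (The function `g` is determined by `f` up to null sets.) -/
def besselNorm {n : ℕ} (α p : ℝ) (f : EuclideanSpace ℝ (Fin n) → ℝ) : ℝ≥0∞ :=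
  ⨅ (g : EuclideanSpace ℝ (Fin n) → ℝ) (_ : IsBesselPotential α p f g),
    eLpNorm g (ENNReal.ofReal p) volume

/-- The Bessel capacity `cap(O; H^α_p)`: the infimum of `‖f‖^p` over the nonnegative Schwartz
functions `f` with `f ≥ 1` on `O`. It is `∞` if there is no such function. -/
def besselCap {n : ℕ} (α p : ℝ) (O : Set (EuclideanSpace ℝ (Fin n))) : ℝ≥0∞ :=
  ⨅ (f : SchwartzMap (EuclideanSpace ℝ (Fin n)) ℝ) (_ : ∀ x, 0 ≤ f x) (_ : ∀ x ∈ O, 1 ≤ f x),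
    besselNorm α p f ^ p

/-- The class `Cap^Φ(H^α_p)` of measures on the upper half-space: `μ(TO) ≤ C Φ(cap(O; H^α_p))`
for all open sets `O`. -/
def capClass (n : ℕ) (α p : ℝ) (Φ : ℝ≥0 → ℝ≥0) : Set (Measure (HalfSpace n)) :=
  {μ | ∃ C : ℝ≥0, ∀ O : Set (EuclideanSpace ℝ (Fin n)), IsOpen O →
    μ (tent O) ≤ C * extendTop Φ (besselCap α p O)}

/-- The Carleson-type class `C^Φ` of measures on the upper half-space: `μ(TB) ≤ C Φ(r)` for all
balls `B` of radius `r`. -/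
def carlesonClass (n : ℕ) (Φ : ℝ≥0 → ℝ≥0) : Set (Measure (HalfSpace n)) :=
  {μ | ∃ C : ℝ≥0, ∀ (x : EuclideanSpace ℝ (Fin n)) (r : ℝ≥0), 0 < r →
    μ (tent (Metric.ball x r)) ≤ C * Φ r}

/-- `Ψ^α(s) = Ψ(s^{n - αp})` for `s < 1` and `Ψ^α(s) = Ψ(s^n)` for `s ≥ 1`. -/
def psiAlpha (n : ℕ) (α p : ℝ) (Ψ : ℝ≥0 → ℝ≥0) (s : ℝ≥0) : ℝ≥0 :=
  if s < 1 then Ψ (s ^ ((n : ℝ) - α * p)) else Ψ (s ^ n)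

end

/-! Write `ballSize` for `β(r) = max (r^{n-αp}) (r^n)`; then `Ψ^α(r) = Ψ(β(r))`. The inclusion of
`Cap^Ψ` in `C^{Ψ^α}` only needs `cap(B_r) ≤ C β(r)`. It is obtained by testing with `G_α * g`, where
`g` is a bump adapted to the ball and divided by the mass `min(r^α, 1)` of `G_α` on it
(`besselCap_ball_le`).

For the converse, let `f = G_α * g ≥ 1` on `O` and let `A ≥ K ‖g‖_p^p`. A point `(x, t)` of the tent
has `B(x, t) ⊆ O`, so the average of `f` over that ball is at least 1. Splitting the kernel
dyadically and applying Hölder at each scale bounds this average by a multiple of `∑ (∫_{B(x,r_k)}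
|g|^p / β(r_k))^{1/p}` with `r_k = 2^{k+1} t` (`one_le_tsum_of_isBesselPotential`). The scales with
`β(r_k) > A` contribute little, by geometric decay. If every other scale satisfied `∫_{B(x,r_k)}
|g|^p < c A Ψ(β(r_k)) / Ψ(A)` with `c` small, the integral condition on `Ψ` would make their sum
small too. Hence some scale carries a large mass of `|g|^p` (`exists_large_mass`).

A Vitali selection among these balls gives disjoint balls whose dilates have tents covering `TO`.
Adding the Carleson bounds yields `μ(TO) ≤ C Ψ(A)` (`measure_tent_le`), and `A` is then taken
comparable to the capacity. Neither a maximal function theorem nor a strong-type capacitary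
inequality enters. -/

/-! ### Pointwise bounds for the Bessel kernel -/

/-- The constant in front of the integral in `besselK`. -/
noncomputable def besselConst (ν : ℝ) : ℝ := √(Real.pi / 2) / Real.Gamma (ν + 1 / 2)

/-- The integral in the representation
`G_α(x) = besselConst ν * e^{-|x|} * |x|^{α - n} * besselInt (ν - 1/2) |x|`. -/
noncomputable def besselInt (a s : ℝ) : ℝ :=
  ∫ u in Set.Ioi (0 : ℝ), Real.exp (-u) * u ^ a * (s + u / 2) ^ a

theorem besselConst_pos {ν : ℝ} (hν : 0 < ν) : 0 < besselConst ν := by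
  unfold besselConst
  have := Real.Gamma_pos_of_pos (s := ν + 1 / 2) (by linarith)
  have := Real.pi_pos
  positivity

/-- Pulling `|x|^a` out of `(|x| + u/2)^a` isolates the singularity `|x|^{α-n}`; the remaining
integral stays bounded above and below near the origin. -/
theorem besselKernel_eq {n : ℕ} {α : ℝ} {x : EuclideanSpace ℝ (Fin n)} (hx : x ≠ 0) :
    besselKernel n α x = besselConst ((n - α) / 2) * Real.exp (-‖x‖) * ‖x‖ ^ (α - n) *
      besselInt ((n - α) / 2 - 1 / 2) ‖x‖ := by
  have hs : 0 < ‖x‖ := norm_pos_iff.2 hx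
  set s := ‖x‖ with hsdef
  set a := ((n : ℝ) - α) / 2 - 1 / 2 with ha
  have h1 : besselInt a s = s ^ a * ∫ u in Set.Ioi (0 : ℝ),
      Real.exp (-u) * u ^ a * (1 + u / (2 * s)) ^ a := by
    rw [besselInt, ← integral_const_mul]
    refine setIntegral_congr_fun measurableSet_Ioi fun u hu => ?_
    have hu : 0 < u := hu
    have : s + u / 2 = s * (1 + u / (2 * s)) := by field_simp
    rw [this, Real.mul_rpow hs.le (by positivity)]
    ring
  rw [besselKernel, besselK, ← hsdef, h1, besselConst, ← ha]
  have h2 : s ^ (α - n) * s ^ a = s ^ ((α - n) / 2) * s ^ (-(1 / 2) : ℝ) := by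
    rw [← Real.rpow_add hs, ← Real.rpow_add hs]
    congr 1
    rw [ha]; ring
  linear_combination (-√(Real.pi / 2) / Real.Gamma (((n : ℝ) - α) / 2 + 1 / 2) * Real.exp (-s) *
    ∫ u in Set.Ioi (0 : ℝ), Real.exp (-u) * u ^ a * (1 + u / (2 * s)) ^ a) * h2

/-- For `a ≥ 0` use `s + u/2 ≤ (1 + s)(1 + u)`; for `a < 0` drop `s`. The point is a majorant that
separates `s` from `u`. -/
theorem add_half_rpow_le (a : ℝ) : ∃ C : ℝ, 0 < C ∧ ∀ s u : ℝ, 0 ≤ s → 0 < u →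
    (s + u / 2) ^ a ≤ C * (1 + s) ^ |a| * (1 + u ^ a) := by
  rcases le_or_gt 0 a with ha | ha
  · refine ⟨2 ^ a, by positivity, fun s u hs hu => ?_⟩
    rw [abs_of_nonneg ha]
    have h1 : (s + u / 2) ^ a ≤ ((1 + s) * (1 + u)) ^ a :=
      Real.rpow_le_rpow (by positivity) (by nlinarith) ha
    have h2 : (1 + u) ^ a ≤ 2 ^ a * (1 + u ^ a) := by
      have h3 : (1 + u) ^ a ≤ (2 * max 1 u) ^ a :=
        Real.rpow_le_rpow (by positivity) (by
          have := le_max_left 1 u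
          have := le_max_right 1 u
          linarith) ha
      rw [Real.mul_rpow (by norm_num) (by positivity)] at h3
      refine h3.trans (mul_le_mul_of_nonneg_left ?_ (by positivity))
      rcases max_choice 1 u with h | h <;> rw [h]
      · rw [Real.one_rpow]; have : 0 < u ^ a := by positivity
        linarith
      · linarith
    rw [Real.mul_rpow (by positivity) (by positivity)] at h1
    calc _ ≤ _ := h1
      _ ≤ (1 + s) ^ a * (2 ^ a * (1 + u ^ a)) := by gcongr
      _ = _ := by ring
  · refine ⟨(1 / 2) ^ a, by positivity, fun s u hs hu => ?_⟩
    have h1 : (s + u / 2) ^ a ≤ (1 / 2 * u) ^ a :=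
      Real.rpow_le_rpow_of_nonpos (by positivity) (by linarith) ha.le
    rw [Real.mul_rpow (by norm_num) hu.le] at h1
    have h2 : 1 ≤ (1 + s) ^ |a| := Real.one_le_rpow (by linarith) (abs_nonneg a)
    have h3 : 0 < u ^ a := by positivity
    have h4 : (0 : ℝ) < (1 / 2) ^ a := by positivity
    calc _ ≤ _ := h1
      _ ≤ (1 / 2) ^ a * (1 + u ^ a) := by gcongr; linarith
      _ ≤ ((1 / 2) ^ a * (1 + s) ^ |a|) * (1 + u ^ a) := by
          gcongr; exact le_mul_of_one_le_right h4.le h2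

/-- The worst term at the origin is `u^{2a}`, which is where `a > -1/2` (that is, `α < n`) enters.
-/
theorem integrableOn_bessel_majorant {a : ℝ} (ha : -(1 / 2) < a) :
    IntegrableOn (fun u : ℝ => Real.exp (-u) * u ^ a * (1 + u ^ a)) (Set.Ioi 0) := by
  have h1 := Real.GammaIntegral_convergent (s := a + 1) (by linarith)
  have h2 := Real.GammaIntegral_convergent (s := 2 * a + 1) (by linarith)
  refine (h1.add h2).congr_fun (fun u hu => ?_) measurableSet_Ioi
  have hu : 0 < u := hu
  simp only [Pi.add_apply, add_sub_cancel_right]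
  rw [two_mul, Real.rpow_add hu]
  ring

theorem integrableOn_besselInt {a : ℝ} (ha : -(1 / 2) < a) {s : ℝ} (hs : 0 ≤ s) :
    IntegrableOn (fun u : ℝ => Real.exp (-u) * u ^ a * (s + u / 2) ^ a) (Set.Ioi 0) := by
  obtain ⟨C, hC, h⟩ := add_half_rpow_le a
  refine ((integrableOn_bessel_majorant ha).const_mul (C * (1 + s) ^ |a|)).mono'
    (by fun_prop) ?_
  filter_upwards [ae_restrict_mem measurableSet_Ioi] with u hu
  have hu : 0 < u := hu
  rw [Real.norm_of_nonneg (by positivity)]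
  calc _ ≤ Real.exp (-u) * u ^ a * (C * (1 + s) ^ |a| * (1 + u ^ a)) := by
        gcongr; exact h s u hs hu
    _ = _ := by ring

theorem besselInt_nonneg {a s : ℝ} (hs : 0 ≤ s) : 0 ≤ besselInt a s :=
  setIntegral_nonneg measurableSet_Ioi fun u hu => by
    have hu : 0 < u := hu
    positivity

theorem besselInt_le {a : ℝ} (ha : -(1 / 2) < a) :
    ∃ C : ℝ, 0 < C ∧ ∀ s : ℝ, 0 ≤ s → besselInt a s ≤ C * (1 + s) ^ |a| := by
  obtain ⟨C, hC, h⟩ := add_half_rpow_le a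
  set I := ∫ u in Set.Ioi (0 : ℝ), Real.exp (-u) * u ^ a * (1 + u ^ a)
  have hI : 0 ≤ I := setIntegral_nonneg measurableSet_Ioi fun u hu => by
    have hu : 0 < u := hu
    positivity
  refine ⟨C * (I + 1), by positivity, fun s hs => ?_⟩
  have : besselInt a s ≤ ∫ u in Set.Ioi (0 : ℝ),
      C * (1 + s) ^ |a| * (Real.exp (-u) * u ^ a * (1 + u ^ a)) := by
    refine setIntegral_mono_on (integrableOn_besselInt ha hs)
      ((integrableOn_bessel_majorant ha).const_mul _) measurableSet_Ioi fun u hu => ?_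
    have hu : 0 < u := hu
    calc _ ≤ Real.exp (-u) * u ^ a * (C * (1 + s) ^ |a| * (1 + u ^ a)) := by
          gcongr; exact h s u hs hu
      _ = _ := by ring
  rw [integral_const_mul] at this
  refine this.trans ?_
  have : 0 ≤ C * (1 + s) ^ |a| := by positivity
  nlinarith

theorem le_besselInt {a : ℝ} (ha : -(1 / 2) < a) :
    ∃ c : ℝ, 0 < c ∧ ∀ s : ℝ, 0 ≤ s → s ≤ 1 → c ≤ besselInt a s := by
  set m : ℝ := min ((1 / 2) ^ a) (2 ^ a) with hm
  have hm0 : 0 < m := by positivity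
  set m' : ℝ := min (1 ^ a) (2 ^ a) with hm'
  have hm'0 : 0 < m' := by positivity
  have key : ∀ b c t : ℝ, 0 < b → b ≤ t → t ≤ c → min (b ^ a) (c ^ a) ≤ t ^ a := by
    intro b c t hb hbt htc
    rcases le_or_gt 0 a with h | h
    · exact (min_le_left _ _).trans (Real.rpow_le_rpow hb.le hbt h)
    · exact (min_le_right _ _).trans
        (Real.rpow_le_rpow_of_nonpos (by linarith) htc h.le)
  refine ⟨Real.exp (-2) * m' * m, by positivity, fun s hs hs1 => ?_⟩
  -- On `1 < u ≤ 2` with `0 ≤ s ≤ 1`, both `u` and `s + u/2` stay in `[1/2, 2]`, so no factor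
  -- degenerates.
  have h1 : ∫ u in Set.Ioc (1 : ℝ) 2, Real.exp (-u) * u ^ a * (s + u / 2) ^ a ≤ besselInt a s := by
    refine setIntegral_mono_set (integrableOn_besselInt ha hs) ?_ ?_
    · filter_upwards [ae_restrict_mem measurableSet_Ioi] with u hu
      have hu : 0 < u := hu
      simp only [Pi.zero_apply]
      positivity
    · exact Filter.Eventually.of_forall fun u hu => lt_trans one_pos hu.1
  have h2 : ∫ u in Set.Ioc (1 : ℝ) 2, Real.exp (-2) * m' * m ≤
      ∫ u in Set.Ioc (1 : ℝ) 2, Real.exp (-u) * u ^ a * (s + u / 2) ^ a := by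
    refine setIntegral_mono_on (integrableOn_const (by simp)) ((integrableOn_besselInt ha hs).mono_set
      fun u hu => lt_trans one_pos hu.1) measurableSet_Ioc fun u hu => ?_
    have hu0 : 0 < u := lt_trans one_pos hu.1
    gcongr
    · exact hu.2
    · exact key 1 2 u one_pos hu.1.le hu.2
    · exact key (1 / 2) 2 _ (by norm_num) (by linarith [hu.1]) (by linarith [hu.2])
  refine le_trans ?_ (h2.trans h1)
  simp [Measure.real]
  norm_num

theorem measurable_besselInt (a : ℝ) : Measurable (besselInt a) := by
  unfold besselInt
  refine (StronglyMeasurable.integral_prod_right (ν := volume.restrict (Set.Ioi (0 : ℝ)))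
    (f := fun s u : ℝ => Real.exp (-u) * u ^ a * (s + u / 2) ^ a) ?_).measurable
  exact Measurable.stronglyMeasurable (by unfold Function.uncurry; fun_prop)

/-- A default value: a real power of `0` with nonzero exponent is `0`. It keeps the global bounds
valid at the origin. -/
theorem besselKernel_zero {n : ℕ} {α : ℝ} (hα : α < n) :
    besselKernel n α 0 = 0 := by
  rw [besselKernel, norm_zero, Real.zero_rpow (by linarith), zero_mul]

theorem besselKernel_nonneg {n : ℕ} {α : ℝ} (hα : α < n) (x : EuclideanSpace ℝ (Fin n)) :
    0 ≤ besselKernel n α x := by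
  rcases eq_or_ne x 0 with rfl | hx
  · rw [besselKernel_zero hα]
  · rw [besselKernel_eq hx]
    have := besselConst_pos (ν := ((n : ℝ) - α) / 2) (by linarith)
    have := besselInt_nonneg (a := ((n : ℝ) - α) / 2 - 1 / 2) (norm_nonneg x)
    positivity

theorem measurable_besselKernel {n : ℕ} {α : ℝ} (hα : α < n) :
    Measurable (besselKernel n α) := by
  have : besselKernel n α = fun x => if x = 0 then 0 else
      besselConst ((n - α) / 2) * Real.exp (-‖x‖) * ‖x‖ ^ (α - n) *
      besselInt ((n - α) / 2 - 1 / 2) ‖x‖ := by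
    ext x
    split_ifs with h
    · rw [h, besselKernel_zero hα]
    · exact besselKernel_eq h
  rw [this]
  have := measurable_besselInt (((n : ℝ) - α) / 2 - 1 / 2)
  exact Measurable.ite (measurableSet_singleton 0) measurable_const (by fun_prop)

theorem besselKernel_le {n : ℕ} {α : ℝ} (hα : α < n) (N : ℕ) :
    ∃ C : ℝ, 0 < C ∧ ∀ x : EuclideanSpace ℝ (Fin n),
      (1 + ‖x‖) ^ N * besselKernel n α x ≤ C * ‖x‖ ^ (α - n) := by
  set a := ((n : ℝ) - α) / 2 - 1 / 2 with ha
  obtain ⟨C, hC, h⟩ := besselInt_le (a := a) (by linarith)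
  obtain ⟨j, hj⟩ := exists_nat_ge |a|
  have hc := besselConst_pos (ν := ((n : ℝ) - α) / 2) (by linarith)
  set c := besselConst (((n : ℝ) - α) / 2) with hcdef
  refine ⟨c * C * ((N + j).factorial * Real.exp 1), by positivity, fun x => ?_⟩
  rcases eq_or_ne x 0 with rfl | hx
  · rw [besselKernel_zero hα, norm_zero, Real.zero_rpow (by linarith)]; simp
  rw [besselKernel_eq hx, ← ha, ← hcdef]
  have hs : 0 < ‖x‖ := norm_pos_iff.2 hx
  set s := ‖x‖
  have h1 : (1 + s) ^ |a| ≤ (1 + s) ^ j := by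
    rw [← Real.rpow_natCast]
    exact Real.rpow_le_rpow_of_exponent_le (by linarith) hj
  have h2 := Real.pow_div_factorial_le_exp (1 + s) (by positivity) (N + j)
  rw [div_le_iff₀ (by positivity), Real.exp_add] at h2
  -- The exponential absorbs both the weight and the growth of `besselInt`: one term of the
  -- exponential series at `1 + s` suffices.
  have h3 : (1 + s) ^ (N + j) * Real.exp (-s) ≤ (N + j).factorial * Real.exp 1 := by
    calc _ ≤ (Real.exp 1 * Real.exp s * (N + j).factorial) * Real.exp (-s) := by gcongr
      _ = (N + j).factorial * Real.exp 1 * (Real.exp s * Real.exp (-s)) := by ring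
      _ = _ := by rw [← Real.exp_add]; simp
  calc (1 + s) ^ N * (c * Real.exp (-s) * s ^ (α - n) * besselInt a s)
      ≤ (1 + s) ^ N * (c * Real.exp (-s) * s ^ (α - n) * (C * (1 + s) ^ j)) := by
        gcongr
        exact (h s hs.le).trans (by gcongr)
    _ = c * C * ((1 + s) ^ (N + j) * Real.exp (-s)) * s ^ (α - n) := by ring
    _ ≤ _ := by gcongr

theorem le_besselKernel {n : ℕ} {α : ℝ} (hα : α < n) :
    ∃ c : ℝ, 0 < c ∧ ∀ x : EuclideanSpace ℝ (Fin n), x ≠ 0 → ‖x‖ ≤ 1 →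
      c * ‖x‖ ^ (α - n) ≤ besselKernel n α x := by
  set a := ((n : ℝ) - α) / 2 - 1 / 2 with ha
  obtain ⟨c, hc, h⟩ := le_besselInt (a := a) (by linarith)
  have hd := besselConst_pos (ν := ((n : ℝ) - α) / 2) (by linarith)
  refine ⟨besselConst (((n : ℝ) - α) / 2) * Real.exp (-1) * c, by positivity, fun x hx hx1 => ?_⟩
  rw [besselKernel_eq hx, ← ha]
  calc _ = besselConst (((n : ℝ) - α) / 2) * Real.exp (-1) * ‖x‖ ^ (α - n) * c := by ring
    _ ≤ _ := by
      gcongr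
      exact h _ (norm_nonneg x) hx1

/-! ### Mass of the kernel on balls -/

/-- The size `min(r^α, 1)` of the mass of `G_α` in the ball of radius `r`. -/
noncomputable def kernelMass (α r : ℝ) : ℝ := min (r ^ α) 1

theorem kernelMass_pos {α r : ℝ} (hr : 0 < r) : 0 < kernelMass α r := by
  unfold kernelMass; positivity

theorem kernelMass_mono {α r s : ℝ} (hα : 0 < α) (hr : 0 < r) (h : r ≤ s) :
    kernelMass α r ≤ kernelMass α s :=
  min_le_min_right _ (Real.rpow_le_rpow hr.le h hα.le)

theorem integrableOn_ball_rpow_norm {n : ℕ} {α : ℝ} (hn : 0 < n) (hα : 0 < α) (s : ℝ) :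
    IntegrableOn (fun x : EuclideanSpace ℝ (Fin n) => ‖x‖ ^ (α - n)) (Metric.ball 0 s) := by
  have : Nonempty (Fin n) := ⟨⟨0, hn⟩⟩
  refine (integrableOn_fun_norm_addHaar volume (f := fun y => y ^ (α - n)) (r := s)).2 ?_
  rw [finrank_euclideanSpace_fin]
  rcases le_or_gt s 0 with h | h
  · simp [Set.Ioo_eq_empty (not_lt.2 h)]
  have := (intervalIntegral.intervalIntegrable_rpow' (a := 0) (b := s) (r := α - 1) (by linarith)).1
  refine (this.mono_set Set.Ioo_subset_Ioc_self).congr_fun (fun y hy => ?_) measurableSet_Ioo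
  have hy : 0 < y := hy.1
  simp only [smul_eq_mul]
  rw [← Real.rpow_natCast, ← Real.rpow_add hy]
  congr 1
  rw [Nat.cast_sub hn]; simp

theorem setIntegral_ball_rpow_norm {n : ℕ} {α : ℝ} (hn : 0 < n) (hα : 0 < α) {s : ℝ} (hs : 0 < s) :
    ∫ x : EuclideanSpace ℝ (Fin n) in Metric.ball 0 s, ‖x‖ ^ (α - n) =
      n * volume.real (Metric.ball (0 : EuclideanSpace ℝ (Fin n)) 1) * (s ^ α / α) := by
  have : Nonempty (Fin n) := ⟨⟨0, hn⟩⟩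
  have h1 := integral_fun_norm_addHaar (volume : Measure (EuclideanSpace ℝ (Fin n)))
    ((Set.Iio s).indicator fun y => y ^ (α - n))
  have h2 : (fun x : EuclideanSpace ℝ (Fin n) =>
      (Set.Iio s).indicator (fun y : ℝ => y ^ (α - n)) ‖x‖) =
      (Metric.ball 0 s).indicator fun x => ‖x‖ ^ (α - n) := by
    ext x; simp [Set.indicator]
  rw [h2, integral_indicator Metric.isOpen_ball.measurableSet, finrank_euclideanSpace_fin] at h1
  rw [h1, nsmul_eq_mul, smul_eq_mul, mul_assoc]
  congr 2
  have h3 : ∀ y ∈ Set.Ioi (0 : ℝ), y ^ (n - 1) • (Set.Iio s).indicator (fun y : ℝ => y ^ (α - n)) y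
      = (Set.Iio s).indicator (fun y : ℝ => y ^ (α - 1)) y := by
    intro y hy
    have hy : 0 < y := hy
    simp only [smul_eq_mul, Set.indicator]
    split_ifs
    · rw [← Real.rpow_natCast, ← Real.rpow_add hy]
      congr 1
      rw [Nat.cast_sub hn]; simp
    · simp
  rw [setIntegral_congr_fun measurableSet_Ioi h3, setIntegral_indicator measurableSet_Iio,
    Set.Ioi_inter_Iio, ← integral_Ioc_eq_integral_Ioo, ← intervalIntegral.integral_of_le hs.le,
    integral_rpow (Or.inl (by linarith))]
  simp [hα.ne']

/-- Inside the unit ball `|x|^{α-n}` dominates; outside, the decay bound with weight `k + n + 1`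
leaves `(1 + |x|)^{-(n+1)}`. -/
theorem integrable_moment_besselKernel {n : ℕ} {α : ℝ} (hn : 0 < n) (hα : 0 < α) (hαn : α < n)
    (k : ℕ) : Integrable (fun x : EuclideanSpace ℝ (Fin n) => ‖x‖ ^ k * besselKernel n α x) := by
  have : Nonempty (Fin n) := ⟨⟨0, hn⟩⟩
  obtain ⟨C, hC, h⟩ := besselKernel_le hαn (k + (n + 1))
  have hm := measurable_besselKernel hαn
  have h1 : Integrable (fun x : EuclideanSpace ℝ (Fin n) =>
      (Metric.ball 0 1).indicator (fun x => ‖x‖ ^ (α - n)) x) :=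
    (integrable_indicator_iff Metric.isOpen_ball.measurableSet).2
      (integrableOn_ball_rpow_norm hn hα 1)
  have h2 : Integrable (fun x : EuclideanSpace ℝ (Fin n) => (1 + ‖x‖) ^ (-((n : ℝ) + 1))) :=
    integrable_one_add_norm (by simp)
  refine ((h1.add h2).const_mul C).mono' (by fun_prop) (Filter.Eventually.of_forall fun x => ?_)
  have h0 := besselKernel_nonneg hαn x
  rw [Real.norm_of_nonneg (by positivity)]
  have h3 : ‖x‖ ^ k * besselKernel n α x ≤ C * (‖x‖ ^ (α - n) / (1 + ‖x‖) ^ (n + 1)) := by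
    rw [← mul_div_assoc, le_div_iff₀ (by positivity)]
    calc ‖x‖ ^ k * besselKernel n α x * (1 + ‖x‖) ^ (n + 1)
        ≤ (1 + ‖x‖) ^ k * besselKernel n α x * (1 + ‖x‖) ^ (n + 1) := by gcongr; linarith
      _ = (1 + ‖x‖) ^ (k + (n + 1)) * besselKernel n α x := by rw [pow_add]; ring
      _ ≤ _ := h x
  refine h3.trans ?_
  simp only [Pi.add_apply]
  gcongr
  have h4 : (1 + ‖x‖) ^ (-((n : ℝ) + 1)) = ((1 + ‖x‖) ^ (n + 1))⁻¹ := by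
    rw [Real.rpow_neg (by positivity), ← Real.rpow_natCast]; simp
  rw [h4]
  by_cases hx : ‖x‖ < 1
  · have : x ∈ Metric.ball (0 : EuclideanSpace ℝ (Fin n)) 1 := by simpa using hx
    rw [Set.indicator_of_mem this]
    have h5 : ‖x‖ ^ (α - n) / (1 + ‖x‖) ^ (n + 1) ≤ ‖x‖ ^ (α - n) :=
      div_le_self (by positivity) (one_le_pow₀ (by linarith [norm_nonneg x]))
    have : 0 ≤ ((1 + ‖x‖) ^ (n + 1))⁻¹ := by positivity
    linarith
  · have h5 : ‖x‖ ^ (α - n) ≤ 1 :=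
      Real.rpow_le_one_of_one_le_of_nonpos (not_lt.1 hx) (by linarith)
    have h6 : 0 ≤ (Metric.ball (0 : EuclideanSpace ℝ (Fin n)) 1).indicator
        (fun x => ‖x‖ ^ (α - n)) x := Set.indicator_nonneg (fun x _ => by positivity) x
    rw [div_eq_mul_inv]
    have : ‖x‖ ^ (α - n) * ((1 + ‖x‖) ^ (n + 1))⁻¹ ≤ 1 * ((1 + ‖x‖) ^ (n + 1))⁻¹ := by gcongr
    linarith

theorem integrable_besselKernel {n : ℕ} {α : ℝ} (hn : 0 < n) (hα : 0 < α) (hαn : α < n) :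
    Integrable (besselKernel n α) := by
  simpa using integrable_moment_besselKernel hn hα hαn 0

theorem lintegral_ball_besselKernel_le {n : ℕ} {α : ℝ} (hn : 0 < n) (hα : 0 < α) (hαn : α < n) :
    ∃ C : ℝ, 0 < C ∧ ∀ s : ℝ, 0 < s →
      ∫⁻ x : EuclideanSpace ℝ (Fin n) in Metric.ball 0 s, ‖besselKernel n α x‖ₑ ≤
        ENNReal.ofReal (C * kernelMass α s) := by
  have : Nonempty (Fin n) := ⟨⟨0, hn⟩⟩
  obtain ⟨C, hC, h⟩ := besselKernel_le hαn 0
  simp only [pow_zero, one_mul] at h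
  have hi := integrable_besselKernel hn hα hαn
  have h0 := besselKernel_nonneg (α := α) hαn
  set V := volume.real (Metric.ball (0 : EuclideanSpace ℝ (Fin n)) 1)
  set A := C * (n * V / α)
  set B := ∫ x, besselKernel n α x
  have hB : 0 ≤ B := integral_nonneg h0
  have hA : 0 ≤ A := by positivity
  refine ⟨A + B + 1, by positivity, fun s hs => ?_⟩
  have e : ∫⁻ x : EuclideanSpace ℝ (Fin n) in Metric.ball 0 s, ‖besselKernel n α x‖ₑ =
      ENNReal.ofReal (∫ x in Metric.ball 0 s, besselKernel n α x) := by
    rw [ofReal_integral_eq_lintegral_ofReal hi.integrableOn (Filter.Eventually.of_forall h0)]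
    simp_rw [Real.enorm_of_nonneg (h0 _)]
  rw [e]
  refine ENNReal.ofReal_le_ofReal ?_
  have h1 : ∫ x in Metric.ball 0 s, besselKernel n α x ≤ A * s ^ α := by
    calc _ ≤ ∫ x : EuclideanSpace ℝ (Fin n) in Metric.ball 0 s, C * ‖x‖ ^ (α - n) :=
          setIntegral_mono hi.integrableOn ((integrableOn_ball_rpow_norm hn hα s).const_mul C) h
      _ = A * s ^ α := by
        rw [integral_const_mul, setIntegral_ball_rpow_norm hn hα hs]; ring
  have h2 : ∫ x in Metric.ball 0 s, besselKernel n α x ≤ B :=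
    setIntegral_le_integral hi (Filter.Eventually.of_forall h0)
  unfold kernelMass
  have h3 : 0 ≤ s ^ α := by positivity
  rcases min_choice (s ^ α) 1 with h | h <;> rw [h] <;> nlinarith

theorem le_integral_ball_besselKernel {n : ℕ} {α : ℝ} (hn : 0 < n) (hα : 0 < α) (hαn : α < n) :
    ∃ c : ℝ, 0 < c ∧ ∀ s : ℝ, 0 < s →
      c * kernelMass α s ≤ ∫ x in Metric.ball 0 s, besselKernel n α x := by
  have : Nonempty (Fin n) := ⟨⟨0, hn⟩⟩
  obtain ⟨c, hc, h⟩ := le_besselKernel hαn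
  have hi := integrable_besselKernel hn hα hαn
  have h0 := besselKernel_nonneg (α := α) hαn
  have hV : 0 < volume.real (Metric.ball (0 : EuclideanSpace ℝ (Fin n)) 1) :=
    ENNReal.toReal_pos (Metric.measure_ball_pos _ _ one_pos).ne' measure_ball_lt_top.ne
  set V := volume.real (Metric.ball (0 : EuclideanSpace ℝ (Fin n)) 1)
  set A := n * V / α
  have hn' : (0 : ℝ) < n := by exact_mod_cast hn
  refine ⟨c * A, by positivity, fun s hs => ?_⟩
  have key : ∀ s : ℝ, 0 < s → s ≤ 1 →
      c * A * s ^ α ≤ ∫ x in Metric.ball 0 s, besselKernel n α x := by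
    intro s hs hs1
    calc c * A * s ^ α = ∫ x : EuclideanSpace ℝ (Fin n) in Metric.ball 0 s, c * ‖x‖ ^ (α - n) := by
          rw [integral_const_mul, setIntegral_ball_rpow_norm hn hα hs]; ring
      _ ≤ _ := by
        refine setIntegral_mono_on ((integrableOn_ball_rpow_norm hn hα s).const_mul c)
          hi.integrableOn Metric.isOpen_ball.measurableSet fun x hx => ?_
        rcases eq_or_ne x 0 with rfl | hx0
        · rw [norm_zero, Real.zero_rpow (by linarith), mul_zero]; exact h0 0
        · exact h x hx0 (by have := mem_ball_zero_iff.1 hx; linarith)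
  rcases le_or_gt s 1 with h1 | h1
  · refine le_trans ?_ (key s hs h1)
    gcongr
    exact min_le_left _ _
  · have := key 1 one_pos le_rfl
    rw [Real.one_rpow] at this
    calc _ ≤ c * A * 1 := by gcongr; exact min_le_right _ _
      _ ≤ _ := this
      _ ≤ _ := setIntegral_mono_set hi.integrableOn (Filter.Eventually.of_forall h0)
          (Filter.Eventually.of_forall (Metric.ball_subset_ball h1.le))

/-- Beyond radius `s` the kernel is no larger than its average over the ball of radius `s`, up to a
constant: `s^{α-n}` for small `s`, and `s^{-n}` for large `s` by the weight `N = n`. -/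
theorem besselKernel_le_of_le_norm {n : ℕ} {α : ℝ} (hα : 0 < α) (hαn : α < n) :
    ∃ C : ℝ, 0 < C ∧ ∀ s : ℝ, 0 < s → ∀ x : EuclideanSpace ℝ (Fin n), s ≤ ‖x‖ →
      besselKernel n α x ≤ C * (kernelMass α s / s ^ n) := by
  obtain ⟨C, hC, h⟩ := besselKernel_le hαn n
  refine ⟨C, hC, fun s hs x hx => ?_⟩
  have h0 := besselKernel_nonneg hαn x
  have hx0 : 0 < ‖x‖ := hs.trans_le hx
  have h1 := h x
  rcases le_or_gt s 1 with hs1 | hs1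
  · have : kernelMass α s / s ^ n = s ^ (α - n) := by
      rw [kernelMass, min_eq_left (Real.rpow_le_one hs.le hs1 hα.le), Real.rpow_sub hs,
        Real.rpow_natCast]
    rw [this]
    calc besselKernel n α x ≤ (1 + ‖x‖) ^ n * besselKernel n α x :=
          le_mul_of_one_le_left h0 (one_le_pow₀ (by linarith))
      _ ≤ C * ‖x‖ ^ (α - n) := h1
      _ ≤ _ := by
        gcongr ?_ * ?_
        exact Real.rpow_le_rpow_of_nonpos hs hx (by linarith)
  · have : kernelMass α s = 1 :=
      min_eq_right (Real.one_le_rpow hs1.le hα.le)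
    rw [this, ← mul_div_assoc, le_div_iff₀ (by positivity)]
    calc besselKernel n α x * s ^ n ≤ besselKernel n α x * (1 + ‖x‖) ^ n := by gcongr; linarith
      _ ≤ C * ‖x‖ ^ (α - n) := by rw [mul_comm]; exact h1
      _ ≤ C * 1 := by
        gcongr
        exact Real.rpow_le_one_of_one_le_of_nonpos (by linarith) (by linarith)

/-! ### Convolutions with test functions are Schwartz -/

open scoped Convolution in
-- All derivatives fall on `g`. Each one changes the target space and the bilinear map, so the
-- induction runs over arbitrary `F`, `F'` and `L`. With no derivatives, `|x| ≤ |t| + R` on the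
-- support trades the weight for moments of `G`.
theorem exists_bound_iteratedFDeriv_convolution {E : Type} [NormedAddCommGroup E]
    [InnerProductSpace ℝ E] [FiniteDimensional ℝ E] [MeasurableSpace E] [BorelSpace E]
    {G : E → ℝ} (hG : ∀ k : ℕ, Integrable fun x => ‖x‖ ^ k * G x) (j : ℕ) :
    ∀ {F F' : Type} [NormedAddCommGroup F] [NormedSpace ℝ F] [NormedAddCommGroup F']
      [NormedSpace ℝ F'] (L : ℝ →L[ℝ] F →L[ℝ] F') {g : E → F}, ContDiff ℝ (⊤ : ℕ∞) g →
      HasCompactSupport g → ∀ k : ℕ, ∃ C, ∀ x,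
        ‖x‖ ^ k * ‖iteratedFDeriv ℝ j (G ⋆[L] g) x‖ ≤ C := by
  have hG0 : Integrable G := by simpa using hG 0
  induction j with
  | zero =>
    intro F F' _ _ _ _ L g hg hgc k
    obtain ⟨R, hR⟩ := hgc.isCompact.isBounded.subset_closedBall (0 : E)
    obtain ⟨M, hM⟩ := hgc.exists_bound_of_continuous hg.continuous
    have hM0 : 0 ≤ M := (norm_nonneg _).trans (hM 0)
    set b : E → ℝ := fun t => ‖L‖ * M * 2 ^ (k - 1) * (‖‖t‖ ^ k * G t‖ + |R| ^ k * ‖G t‖)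
    have hb : Integrable b := ((hG k).norm.add (hG0.norm.const_mul _)).const_mul _
    refine ⟨∫ t, b t, fun x => ?_⟩
    rw [norm_iteratedFDeriv_zero, convolution_def]
    have : ‖x‖ ^ k * ‖∫ t, L (G t) (g (x - t))‖ = ‖∫ t, ‖x‖ ^ k • L (G t) (g (x - t))‖ := by
      rw [integral_smul, norm_smul, norm_pow, norm_norm]
    rw [this]
    refine norm_integral_le_of_norm_le hb (Filter.Eventually.of_forall fun t => ?_)
    rw [norm_smul, norm_pow, norm_norm]
    by_cases h0 : g (x - t) = 0
    · rw [h0, map_zero, norm_zero, mul_zero]; positivity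
    · have h1 : ‖x - t‖ ≤ |R| := by
        have := hR (subset_tsupport g h0)
        exact (mem_closedBall_zero_iff.1 this).trans (le_abs_self R)
      have h2 : ‖x‖ ≤ ‖t‖ + |R| := by
        calc ‖x‖ = ‖t + (x - t)‖ := by congr 1; abel
          _ ≤ _ := (norm_add_le _ _).trans (by gcongr)
      have h3 : ‖x‖ ^ k ≤ 2 ^ (k - 1) * (‖t‖ ^ k + |R| ^ k) :=
        (pow_le_pow_left₀ (norm_nonneg x) h2 k).trans (add_pow_le (norm_nonneg _) (abs_nonneg _) k)
      calc ‖x‖ ^ k * ‖L (G t) (g (x - t))‖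
          ≤ (2 ^ (k - 1) * (‖t‖ ^ k + |R| ^ k)) * (‖L‖ * ‖G t‖ * M) := by
            gcongr
            exact (L.le_opNorm₂ _ _).trans (by gcongr; exact hM _)
        _ = b t := by
            simp only [b, norm_mul, norm_pow, norm_norm]; ring
  | succ j ih =>
    intro F F' _ _ _ _ L g hg hgc k
    have hd : fderiv ℝ (G ⋆[L] g) = G ⋆[L.precompR E] fderiv ℝ g := by
      ext1 x
      exact (hgc.hasFDerivAt_convolution_right L hG0.locallyIntegrable
        (hg.of_le (by exact_mod_cast le_top)) x).fderiv
    obtain ⟨C, hC⟩ := ih (L.precompR E) (hg.fderiv_right (m := (⊤ : ℕ∞)) (by simp))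
      (hgc.fderiv ℝ) k
    refine ⟨C, fun x => ?_⟩
    rw [← norm_iteratedFDeriv_fderiv, hd]
    exact hC x

/-- The convolution of a kernel with finite moments and a test function is a Schwartz function. -/
noncomputable def schwartzConvolution {n : ℕ} {G : EuclideanSpace ℝ (Fin n) → ℝ}
    (hG : ∀ k : ℕ, Integrable fun x => ‖x‖ ^ k * G x) {g : EuclideanSpace ℝ (Fin n) → ℝ}
    (hg : ContDiff ℝ (⊤ : ℕ∞) g) (hgc : HasCompactSupport g) :
    SchwartzMap (EuclideanSpace ℝ (Fin n)) ℝ where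
  toFun := convolution G g (ContinuousLinearMap.mul ℝ ℝ) volume
  smooth' := hgc.contDiff_convolution_right _
    (by simpa using (hG 0).locallyIntegrable) hg
  decay' k j := exists_bound_iteratedFDeriv_convolution hG j _ hg hgc k

/-! ### Capacity of balls -/

theorem eLpNorm_ofReal_rpow {X : Type*} [MeasurableSpace X] {μ : Measure X} {p : ℝ} (hp : 0 < p)
    (g : X → ℝ) : eLpNorm g (ENNReal.ofReal p) μ ^ p = ∫⁻ x, ‖g x‖ₑ ^ p ∂μ := by
  rw [eLpNorm_eq_lintegral_rpow_enorm_toReal (by simpa using hp) (by simp),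
    ENNReal.toReal_ofReal hp.le, ← ENNReal.rpow_mul, one_div, inv_mul_cancel₀ hp.ne',
    ENNReal.rpow_one]

/-- The size `max (r^{n - αp}) (r^n)` of the capacity of a ball of radius `r`. -/
noncomputable def ballSize (n : ℕ) (α p : ℝ) (r : ℝ≥0) : ℝ≥0 :=
  max (r ^ ((n : ℝ) - α * p)) (r ^ n)

theorem ballSize_pos {n : ℕ} {α p : ℝ} {r : ℝ≥0} (hr : 0 < r) : 0 < ballSize n α p r :=
  lt_max_of_lt_right (pow_pos hr n)

/-- The scaling relation behind both inclusions. The maximum and the minimum switch at the same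
radius `r = 1`. -/
theorem ballSize_mul_kernelMass_rpow {n : ℕ} {α p : ℝ} (hα : 0 < α) (hp : 0 < p) {r : ℝ≥0}
    (hr : 0 < r) : (ballSize n α p r : ℝ) * kernelMass α r ^ p = (r : ℝ) ^ n := by
  have hr' : (0 : ℝ) < r := hr
  have hm := mul_pos hα hp
  have e : (r : ℝ) ^ ((n : ℝ) - α * p) * ((r : ℝ) ^ α) ^ p = (r : ℝ) ^ n := by
    rw [← Real.rpow_mul hr'.le, ← Real.rpow_add hr', ← Real.rpow_natCast]; simp
  rw [ballSize, kernelMass, NNReal.coe_max, NNReal.coe_rpow, NNReal.coe_pow]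
  rcases le_total (r : ℝ) 1 with h | h
  · rw [max_eq_left, min_eq_left (Real.rpow_le_one hr'.le h hα.le), e]
    rw [← Real.rpow_natCast]
    exact Real.rpow_le_rpow_of_exponent_ge hr' h (by linarith)
  · rw [max_eq_right, min_eq_right (Real.one_le_rpow h hα.le), Real.one_rpow, mul_one]
    rw [← Real.rpow_natCast]
    exact Real.rpow_le_rpow_of_exponent_le h (by linarith)

theorem psiAlpha_eq {n : ℕ} {α p : ℝ} (hα : 0 < α) (hp : 0 < p) (Ψ : ℝ≥0 → ℝ≥0) {r : ℝ≥0}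
    (hr : 0 < r) : psiAlpha n α p Ψ r = Ψ (ballSize n α p r) := by
  have hm := mul_pos hα hp
  unfold psiAlpha ballSize
  split_ifs with h
  · rw [max_eq_left]
    rw [← NNReal.rpow_natCast]
    exact NNReal.rpow_le_rpow_of_exponent_ge hr h.le (by linarith)
  · rw [max_eq_right]
    rw [← NNReal.rpow_natCast]
    exact NNReal.rpow_le_rpow_of_exponent_le (not_lt.1 h) (by linarith)

/-- The capacity of a ball of radius `r` is at most `C * max (r^{n - αp}) (r^n)`. -/
theorem besselCap_ball_le {n : ℕ} {α p : ℝ} (hn : 0 < n) (hα : 0 < α) (hαn : α < n) (hp : 0 < p) :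
    ∃ C : ℝ≥0, ∀ (x₀ : EuclideanSpace ℝ (Fin n)) (r : ℝ≥0), 0 < r →
      besselCap α p (Metric.ball x₀ r) ≤ C * ballSize n α p r := by
  have : Nonempty (Fin n) := ⟨⟨0, hn⟩⟩
  obtain ⟨c, hc, hball⟩ := le_integral_ball_besselKernel hn hα hαn
  have hmom := integrable_moment_besselKernel hn hα hαn
  have hi := integrable_besselKernel hn hα hαn
  have h0 := besselKernel_nonneg (α := α) hαn
  have hV : volume (Metric.ball (0 : EuclideanSpace ℝ (Fin n)) 1) ≠ ∞ := measure_ball_lt_top.ne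
  set V := (volume (Metric.ball (0 : EuclideanSpace ℝ (Fin n)) 1)).toNNReal with hVdef
  refine ⟨Real.toNNReal (c ^ (-p) * 3 ^ n) * V, fun x₀ r hr => ?_⟩
  have hr' : (0 : ℝ) < r := hr
  have hτ := kernelMass_pos (α := α) hr'
  set τ := kernelMass α r with hτdef
  -- Inner radius `2r`: if `x` is in the ball and `|t| < r`, then `x - t` still lies where the bump
  -- equals 1.
  set φ : ContDiffBump x₀ := ⟨2 * r, 3 * r, by positivity, by linarith⟩ with hφ
  -- Normalized by the lower bound for the kernel mass on `B_r`, so that the potential reaches 1 on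
  -- the ball.
  set lam : ℝ := (c * τ)⁻¹ with hlam
  have hlam0 : 0 < lam := by positivity
  set g : EuclideanSpace ℝ (Fin n) → ℝ := fun x => lam * φ x with hg
  have hgs : ContDiff ℝ (⊤ : ℕ∞) g := contDiff_const.mul φ.contDiff
  have hgc : HasCompactSupport g := φ.hasCompactSupport.mul_left
  have hg0 : ∀ x, 0 ≤ g x := fun x => mul_nonneg hlam0.le φ.nonneg
  have hgle : ∀ x, g x ≤ lam := fun x => mul_le_of_le_one_right hlam0.le φ.le_one
  set f := schwartzConvolution hmom hgs hgc
  have hfx : ∀ x, f x = ∫ t, besselKernel n α t * g (x - t) := fun x => rfl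
  have hint : ∀ x, Integrable fun t => besselKernel n α t * g (x - t) := fun x =>
    hi.mul_bdd (c := lam) (by have := hgs.continuous; fun_prop)
      (Filter.Eventually.of_forall fun t => by
      rw [Real.norm_of_nonneg (hg0 _)]; exact hgle _)
  have hf0 : ∀ x, 0 ≤ f x := fun x => by
    rw [hfx]; exact integral_nonneg fun t => mul_nonneg (h0 t) (hg0 _)
  have hf1 : ∀ x ∈ Metric.ball x₀ (r : ℝ), 1 ≤ f x := by
    intro x hx
    rw [hfx]
    calc (1 : ℝ) = c * τ * lam := by rw [hlam, mul_inv_cancel₀ (by positivity)]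
      _ ≤ (∫ t in Metric.ball 0 (r : ℝ), besselKernel n α t) * lam := by
          gcongr; exact hball r hr'
      _ = ∫ t in Metric.ball 0 (r : ℝ), besselKernel n α t * g (x - t) := by
          rw [← integral_mul_const]
          refine setIntegral_congr_fun Metric.isOpen_ball.measurableSet fun t ht => ?_
          have : φ (x - t) = 1 := by
            refine φ.one_of_mem_closedBall ?_
            rw [mem_closedBall_iff_norm]
            have h1 := mem_ball_iff_norm.1 hx
            have h2 := mem_ball_zero_iff.1 ht
            calc ‖x - t - x₀‖ = ‖(x - x₀) - t‖ := by congr 1; abel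
              _ ≤ ‖x - x₀‖ + ‖t‖ := norm_sub_le _ _
              _ ≤ 2 * r := by linarith
          simp [g, this]
      _ ≤ _ := setIntegral_le_integral (hint x)
          (Filter.Eventually.of_forall fun t => mul_nonneg (h0 t) (hg0 _))
  have hpot : IsBesselPotential α p f g :=
    ⟨hgs.continuous.memLp_of_hasCompactSupport hgc, Filter.EventuallyEq.rfl⟩
  have h1 : besselCap α p (Metric.ball x₀ (r : ℝ)) ≤ ∫⁻ x, ‖g x‖ₑ ^ p := by
    rw [← eLpNorm_ofReal_rpow hp]
    exact (iInf_le_of_le f <| iInf_le_of_le hf0 <| iInf_le_of_le hf1 le_rfl).trans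
      (ENNReal.rpow_le_rpow (iInf₂_le g hpot) hp.le)
  have h2 : ∫⁻ x, ‖g x‖ₑ ^ p ≤ ENNReal.ofReal (lam ^ p) *
      volume (Metric.ball x₀ (3 * (r : ℝ))) := by
    rw [← setLIntegral_const, ← lintegral_indicator Metric.isOpen_ball.measurableSet]
    refine lintegral_mono fun x => ?_
    by_cases hx : x ∈ Metric.ball x₀ (3 * (r : ℝ))
    · rw [Set.indicator_of_mem hx, Real.enorm_of_nonneg (hg0 x),
        ENNReal.ofReal_rpow_of_nonneg (hg0 x) hp.le]
      exact ENNReal.ofReal_le_ofReal (Real.rpow_le_rpow (hg0 x) (hgle x) hp.le)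
    · have : φ x = 0 := φ.zero_of_le_dist (by simpa using hx)
      simp [g, this, hp]
  refine h1.trans (h2.trans ?_)
  rw [Measure.addHaar_ball _ _ (by positivity), finrank_euclideanSpace_fin,
    ← ENNReal.coe_toNNReal hV, ← hVdef, ← mul_assoc, ← ENNReal.ofReal_mul (by positivity)]
  have h3 : lam ^ p * (3 * (r : ℝ)) ^ n = c ^ (-p) * 3 ^ n * ballSize n α p r := by
    rw [mul_pow, ← ballSize_mul_kernelMass_rpow hα hp hr, hlam, Real.inv_rpow (by positivity),
      Real.mul_rpow hc.le hτ.le, Real.rpow_neg hc.le, ← hτdef]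
    have := Real.rpow_pos_of_pos hτ p
    field_simp
  rw [h3, ENNReal.ofReal_mul (by positivity), ENNReal.ofReal_coe_nnreal]
  rw [ENNReal.coe_mul, ENNReal.ofReal]
  exact le_of_eq (by ring)

/-! ### Averages of Bessel potentials over balls -/

theorem kernelMass_mul_le {α c r : ℝ} (hα : 0 < α) (hc : 1 ≤ c) (hr : 0 < r) :
    kernelMass α (c * r) ≤ c ^ α * kernelMass α r := by
  unfold kernelMass
  have h1 : 1 ≤ c ^ α := Real.one_le_rpow hc hα.le
  rw [Real.mul_rpow (by linarith) hr.le, mul_min_of_nonneg _ _ (by positivity)]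
  exact min_le_min_left _ (by linarith)

/-- The Bessel kernel is dominated by its restriction to the ball of radius `2t` and a dyadic sum
of step functions. -/
theorem enorm_besselKernel_sub_le {n : ℕ} {α : ℝ} (hα : 0 < α) (hαn : α < n) :
    ∃ C : ℝ, 0 < C ∧ ∀ (x z : EuclideanSpace ℝ (Fin n)) (t : ℝ≥0), 0 < t →
      z ∈ Metric.ball x (t : ℝ) → ∀ y,
      ‖besselKernel n α (z - y)‖ₑ ≤
        (Metric.ball x (2 * (t : ℝ))).indicator (fun y => ‖besselKernel n α (z - y)‖ₑ) y +
        ∑' k : ℕ, (Metric.ball x ((2 ^ (k + 1) * t : ℝ≥0) : ℝ)).indicator (fun _ =>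
          ENNReal.ofReal (C * (kernelMass α (2 ^ (k + 1) * t : ℝ≥0) /
            ((2 ^ (k + 1) * t : ℝ≥0) : ℝ) ^ n))) y := by
  obtain ⟨C, hC, h⟩ := besselKernel_le_of_le_norm (n := n) hα hαn
  refine ⟨C * 4 ^ n, by positivity, fun x z t ht hz y => ?_⟩
  have ht' : (0 : ℝ) < t := ht
  by_cases hy : y ∈ Metric.ball x (2 * (t : ℝ))
  · rw [Set.indicator_of_mem hy]; exact le_self_add
  have hd : 2 * (t : ℝ) ≤ dist y x := by simpa using hy
  obtain ⟨m, hm1, hm2⟩ := exists_nat_pow_near (x := dist y x / (2 * t)) (y := (2 : ℝ))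
    ((one_le_div (by positivity)).2 hd) one_lt_two
  rw [le_div_iff₀ (by positivity)] at hm1
  rw [div_lt_iff₀ (by positivity)] at hm2
  -- Here `r/2 ≤ |y - x| < r` and `|z - x| < t ≤ r/4`, so `|z - y| ≥ r/4`; this quarter gives the
  -- factor `4^n`. In the sum this is the term of index `m + 1`.
  set r : ℝ≥0 := 2 ^ (m + 1 + 1) * t with hr
  have hrr : (r : ℝ) = 2 ^ (m + 1) * (2 * t) := by rw [hr]; push_cast; ring
  have hr0 : (0 : ℝ) < r := by rw [hrr]; positivity
  have hz' : dist z x < t := hz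
  have htr : (t : ℝ) ≤ r / 4 := by
    rw [hrr]
    have : (1 : ℝ) ≤ 2 ^ m := one_le_pow₀ one_le_two
    rw [pow_succ]; nlinarith
  have hzy : (r : ℝ) / 4 ≤ ‖z - y‖ := by
    have h1 : dist y x ≤ dist z y + dist z x := by
      rw [dist_comm z y]; exact dist_triangle y z x
    rw [← dist_eq_norm]
    have h2 : (r : ℝ) / 2 = 2 ^ m * (2 * t) := by rw [hrr]; ring
    linarith
  have hk := h (r / 4) (by positivity) (z - y) hzy
  refine le_trans ?_ le_add_self
  refine le_trans ?_ (ENNReal.le_tsum (m + 1))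
  rw [Set.indicator_of_mem (by rw [Metric.mem_ball, ← hr, hrr]; exact hm2),
    Real.enorm_of_nonneg (besselKernel_nonneg hαn _), ← hr]
  refine ENNReal.ofReal_le_ofReal (hk.trans ?_)
  have h3 := kernelMass_mono (α := α) hα (by positivity : 0 < (r : ℝ) / 4)
    (by linarith : (r : ℝ) / 4 ≤ r)
  calc C * (kernelMass α (r / 4) / (r / 4) ^ n) ≤ C * (kernelMass α r / (r / 4) ^ n) := by gcongr
    _ = _ := by rw [div_pow]; field_simp

theorem setLIntegral_ball_comp_sub_le {E : Type*} [SeminormedAddCommGroup E] [MeasurableSpace E]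
    [BorelSpace E] {μ : Measure E} [μ.IsAddRightInvariant] (F : E → ℝ≥0∞) {x y : E} {s t : ℝ}
    (hy : y ∈ Metric.ball x s) :
    ∫⁻ z in Metric.ball x t, F (z - y) ∂μ ≤ ∫⁻ z in Metric.ball 0 (s + t), F z ∂μ := by
  rw [← lintegral_indicator Metric.isOpen_ball.measurableSet,
    ← lintegral_indicator Metric.isOpen_ball.measurableSet,
    ← lintegral_sub_right_eq_self ((Metric.ball 0 (s + t)).indicator F) y]
  refine lintegral_mono fun z => ?_
  by_cases hz : z ∈ Metric.ball x t
  · rw [Set.indicator_of_mem hz, Set.indicator_of_mem]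
    rw [mem_ball_zero_iff, ← dist_eq_norm]
    have h1 := Metric.mem_ball.1 hz
    have h2 := Metric.mem_ball'.1 hy
    linarith [dist_triangle z x y]
  · rw [Set.indicator_of_notMem hz]; exact zero_le

/-- The average of `G_α * |g|` over a ball is dominated by a dyadic sum of averages of `|g|`. -/
theorem lintegral_ball_potential_le {n : ℕ} {α : ℝ} (hn : 0 < n) (hα : 0 < α) (hαn : α < n) :
    ∃ C : ℝ≥0, ∀ g : EuclideanSpace ℝ (Fin n) → ℝ, AEStronglyMeasurable g →
      ∀ (x : EuclideanSpace ℝ (Fin n)) (t : ℝ≥0), 0 < t →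
      ∫⁻ z in Metric.ball x (t : ℝ), ∫⁻ y, ‖besselKernel n α (z - y)‖ₑ * ‖g y‖ₑ ≤
        C * volume (Metric.ball x (t : ℝ)) * ∑' k : ℕ,
          ENNReal.ofReal (kernelMass α (2 ^ (k + 1) * t : ℝ≥0) /
            ((2 ^ (k + 1) * t : ℝ≥0) : ℝ) ^ n) *
          ∫⁻ y in Metric.ball x ((2 ^ (k + 1) * t : ℝ≥0) : ℝ), ‖g y‖ₑ := by
  have : Nonempty (Fin n) := ⟨⟨0, hn⟩⟩
  obtain ⟨C₁, hC₁, h₁⟩ := enorm_besselKernel_sub_le (n := n) hα hαn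
  obtain ⟨C₂, hC₂, h₂⟩ := lintegral_ball_besselKernel_le hn hα hαn
  have hG := measurable_besselKernel hαn
  have hV : volume (Metric.ball (0 : EuclideanSpace ℝ (Fin n)) 1) ≠ ∞ := measure_ball_lt_top.ne
  have hV0 : 0 < volume (Metric.ball (0 : EuclideanSpace ℝ (Fin n)) 1) :=
    Metric.measure_ball_pos _ _ one_pos
  set V := (volume (Metric.ball (0 : EuclideanSpace ℝ (Fin n)) 1)).toNNReal with hVdef
  have hVe : volume (Metric.ball (0 : EuclideanSpace ℝ (Fin n)) 1) = V :=
    (ENNReal.coe_toNNReal hV).symm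
  have hVpos : 0 < V := ENNReal.toNNReal_pos hV0.ne' hV
  refine ⟨Real.toNNReal (C₂ * 2 ^ α * 2 ^ n) * V⁻¹ + Real.toNNReal C₁, fun g hg x t ht => ?_⟩
  have ht' : (0 : ℝ) < t := ht
  set r : ℕ → ℝ≥0 := fun k => 2 ^ (k + 1) * t with hr
  set S := ∑' k : ℕ, ENNReal.ofReal (kernelMass α (r k) / (r k : ℝ) ^ n) *
    ∫⁻ y in Metric.ball x (r k : ℝ), ‖g y‖ₑ with hS
  have hge : AEMeasurable (fun y => ‖g y‖ₑ) := hg.enorm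
  have hbm : ∀ s : ℝ, MeasurableSet (Metric.ball x s) := fun s => Metric.isOpen_ball.measurableSet
  have hr0 : 2 * (t : ℝ) = r 0 := by simp [hr]
  have e1 : ∀ z ∈ Metric.ball x (t : ℝ), ∫⁻ y, ‖besselKernel n α (z - y)‖ₑ * ‖g y‖ₑ ≤
      (∫⁻ y in Metric.ball x (2 * (t : ℝ)), ‖besselKernel n α (z - y)‖ₑ * ‖g y‖ₑ) +
        ENNReal.ofReal C₁ * S := by
    intro z hz
    have e2 : ENNReal.ofReal C₁ * S = ∫⁻ y, ∑' k : ℕ, (Metric.ball x (r k : ℝ)).indicator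
        (fun _ => ENNReal.ofReal (C₁ * (kernelMass α (r k) / (r k : ℝ) ^ n))) y * ‖g y‖ₑ := by
      rw [lintegral_tsum (f := fun k y => (Metric.ball x (r k : ℝ)).indicator
        (fun _ => ENNReal.ofReal (C₁ * (kernelMass α (r k) / (r k : ℝ) ^ n))) y * ‖g y‖ₑ)
        (fun k => (aemeasurable_const.indicator (hbm _)).mul hge), hS,
        ← ENNReal.tsum_mul_left]
      congr 1 with k
      have e : ∀ y, (Metric.ball x (r k : ℝ)).indicator
          (fun _ => ENNReal.ofReal (C₁ * (kernelMass α (r k) / (r k : ℝ) ^ n))) y * ‖g y‖ₑ =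
          (Metric.ball x (r k : ℝ)).indicator
          (fun y => ENNReal.ofReal (C₁ * (kernelMass α (r k) / (r k : ℝ) ^ n)) * ‖g y‖ₑ) y :=
        fun y => by simp only [Set.indicator, ite_mul, zero_mul]
      simp_rw [e]
      rw [lintegral_indicator (hbm _), lintegral_const_mul'' _ hge.restrict,
        ENNReal.ofReal_mul hC₁.le, mul_assoc]
    rw [e2, ← lintegral_indicator (hbm _), ← lintegral_add_left']
    · refine lintegral_mono fun y => ?_
      rw [ENNReal.tsum_mul_right, Set.indicator_mul_left, ← add_mul]
      gcongr
      exact h₁ x z t ht hz y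
    · exact AEMeasurable.indicator (by fun_prop) (hbm _)
  -- By Tonelli, each `y` within `2t` meets the kernel only on a ball of radius `3t ≤ 2 · 2t`, hence
  -- the factor `2^α`.
  have e3 : ∫⁻ z in Metric.ball x (t : ℝ), ∫⁻ y in Metric.ball x (2 * (t : ℝ)),
      ‖besselKernel n α (z - y)‖ₑ * ‖g y‖ₑ ≤
      ENNReal.ofReal (C₂ * 2 ^ α * kernelMass α (r 0)) *
        ∫⁻ y in Metric.ball x (r 0 : ℝ), ‖g y‖ₑ := by
    rw [lintegral_lintegral_swap, ← hr0, ← lintegral_const_mul'' _ hge.restrict]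
    · refine setLIntegral_mono_ae' (hbm _) (Filter.Eventually.of_forall fun y hy => ?_)
      rw [lintegral_mul_const' _ _ enorm_ne_top]
      gcongr
      refine (setLIntegral_ball_comp_sub_le (fun w => ‖besselKernel n α w‖ₑ) hy).trans ?_
      refine (h₂ _ (by positivity)).trans (ENNReal.ofReal_le_ofReal ?_)
      rw [mul_assoc]
      gcongr
      refine (kernelMass_mono hα (by positivity) (by linarith)).trans
        (kernelMass_mul_le hα one_le_two (by positivity))
    · have : AEMeasurable (fun y => ‖g y‖ₑ)
          (volume.restrict (Metric.ball x (2 * (t : ℝ)))) := hge.restrict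
      refine AEMeasurable.mul (by fun_prop) this.comp_snd
  -- The near part is absorbed into the term `k = 0`, of radius `2t`; this costs `2^n`.
  have e4 : ENNReal.ofReal (C₂ * 2 ^ α * kernelMass α (r 0)) *
        ∫⁻ y in Metric.ball x (r 0 : ℝ), ‖g y‖ₑ ≤
      Real.toNNReal (C₂ * 2 ^ α * 2 ^ n) * (V⁻¹ : ℝ≥0) * volume (Metric.ball x (t : ℝ)) * S := by
    have hk : C₂ * 2 ^ α * kernelMass α (r 0) = (C₂ * 2 ^ α * 2 ^ n) * ((t : ℝ) ^ n) *
        (kernelMass α (r 0) / (r 0 : ℝ) ^ n) := by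
      rw [← hr0]; field_simp; ring
    have hv : (V⁻¹ : ℝ≥0) * volume (Metric.ball x (t : ℝ)) = ENNReal.ofReal ((t : ℝ) ^ n) := by
      rw [Measure.addHaar_ball _ _ (by positivity), hVe, finrank_euclideanSpace_fin,
        mul_left_comm, ← ENNReal.coe_mul, inv_mul_cancel₀ hVpos.ne']
      simp
    rw [mul_assoc (Real.toNNReal _ : ℝ≥0∞), hv, hk, ENNReal.ofReal_mul (by positivity),
      ENNReal.ofReal_mul (by positivity), mul_assoc]
    exact mul_le_mul_right (ENNReal.le_tsum (f := fun k =>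
      ENNReal.ofReal (kernelMass α (r k) / (r k : ℝ) ^ n) *
        ∫⁻ y in Metric.ball x (r k : ℝ), ‖g y‖ₑ) 0) _
  calc _ ≤ ∫⁻ z in Metric.ball x (t : ℝ), ((∫⁻ y in Metric.ball x (2 * (t : ℝ)),
        ‖besselKernel n α (z - y)‖ₑ * ‖g y‖ₑ) + ENNReal.ofReal C₁ * S) :=
        setLIntegral_mono_ae' (hbm _) (Filter.Eventually.of_forall e1)
    _ = (∫⁻ z in Metric.ball x (t : ℝ), ∫⁻ y in Metric.ball x (2 * (t : ℝ)),
        ‖besselKernel n α (z - y)‖ₑ * ‖g y‖ₑ) +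
        ENNReal.ofReal C₁ * S * volume (Metric.ball x (t : ℝ)) := by
        rw [lintegral_add_right _ measurable_const, setLIntegral_const]
    _ ≤ _ := by
        push_cast
        rw [add_mul, add_mul]
        refine add_le_add (e3.trans e4) (le_of_eq ?_)
        rw [ENNReal.ofReal]; ring

/-- Hölder on the ball: the factor `r^{n(1-1/p)}` turns `kernelMass α r / r^n` into `kernelMass α r
/ r^{n/p}`, which is `ballSize^{-1/p}`. -/
theorem kernelMass_div_mul_lintegral_ball_le {n : ℕ} {α p : ℝ} (hn : 0 < n) (hα : 0 < α)
    (hp : 1 < p) :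
    ∃ C : ℝ≥0, ∀ g : EuclideanSpace ℝ (Fin n) → ℝ, AEStronglyMeasurable g →
      ∀ (x : EuclideanSpace ℝ (Fin n)) (r : ℝ≥0), 0 < r →
      ENNReal.ofReal (kernelMass α r / (r : ℝ) ^ n) * ∫⁻ y in Metric.ball x (r : ℝ), ‖g y‖ₑ ≤
        C * ((∫⁻ y in Metric.ball x (r : ℝ), ‖g y‖ₑ ^ p) / ballSize n α p r) ^ (1 / p) := by
  have : Nonempty (Fin n) := ⟨⟨0, hn⟩⟩
  have hp0 : 0 < p := by linarith
  have hV : volume (Metric.ball (0 : EuclideanSpace ℝ (Fin n)) 1) ≠ ∞ := measure_ball_lt_top.ne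
  set V := (volume (Metric.ball (0 : EuclideanSpace ℝ (Fin n)) 1)).toNNReal with hVdef
  have hVe : volume (Metric.ball (0 : EuclideanSpace ℝ (Fin n)) 1) = V :=
    (ENNReal.coe_toNNReal hV).symm
  have hpq := Real.HolderConjugate.conjExponent hp
  set q := Real.conjExponent p with hq
  have hq0 : 0 < q := hpq.symm.pos
  refine ⟨V ^ (1 / q), fun g hg x r hr => ?_⟩
  have hr' : (0 : ℝ) < r := hr
  have hu : 0 < ballSize n α p r := ballSize_pos hr
  have hτ := kernelMass_pos (α := α) hr'
  have hge : AEMeasurable (fun y => ‖g y‖ₑ) (volume.restrict (Metric.ball x (r : ℝ))) :=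
    hg.enorm.restrict
  have h1 := ENNReal.lintegral_mul_le_Lp_mul_Lq (volume.restrict (Metric.ball x (r : ℝ))) hpq hge
    (aemeasurable_const (b := (1 : ℝ≥0∞)))
  simp only [Pi.mul_apply, mul_one, ENNReal.one_rpow, setLIntegral_const, one_mul] at h1
  have h2 : volume (Metric.ball x (r : ℝ)) = V * ENNReal.ofReal ((r : ℝ) ^ n) := by
    rw [Measure.addHaar_ball _ _ (by positivity), hVe, finrank_euclideanSpace_fin, mul_comm]
  have h3 : kernelMass α r / (r : ℝ) ^ n * ((r : ℝ) ^ n) ^ (1 / q) =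
      ((ballSize n α p r : ℝ)⁻¹) ^ (1 / p) := by
    have hb := ballSize_mul_kernelMass_rpow (n := n) hα hp0 hr
    have hu' : (0 : ℝ) < ballSize n α p r := hu
    have e : 1 / q = 1 - 1 / p := by
      have := hpq.inv_add_inv_eq_one
      rw [one_div, one_div]; linarith
    have hrn : (0 : ℝ) < (r : ℝ) ^ n := by positivity
    rw [e, Real.rpow_sub hrn, Real.rpow_one, div_mul_div_cancel₀ hrn.ne', ← hb,
      Real.mul_rpow hu'.le (by positivity), ← Real.rpow_mul hτ.le, mul_one_div_cancel hp0.ne',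
      Real.rpow_one, Real.inv_rpow hu'.le]
    field_simp
  have h4 : ENNReal.ofReal (kernelMass α r / (r : ℝ) ^ n) *
      (ENNReal.ofReal ((r : ℝ) ^ n)) ^ (1 / q) = ((ballSize n α p r : ℝ≥0∞)⁻¹) ^ (1 / p) := by
    rw [ENNReal.ofReal_rpow_of_nonneg (by positivity) (by positivity),
      ← ENNReal.ofReal_mul (by positivity), h3, ← ENNReal.ofReal_rpow_of_nonneg (by positivity)
      (by positivity), ENNReal.ofReal_inv_of_pos (NNReal.coe_pos.2 hu), ENNReal.ofReal_coe_nnreal]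
  rw [h2, ENNReal.mul_rpow_of_nonneg _ _ (by positivity)] at h1
  rw [ENNReal.div_eq_inv_mul, ENNReal.mul_rpow_of_nonneg _ _ (by positivity), ← h4,
    ENNReal.coe_rpow_of_nonneg _ (by positivity)]
  refine (mul_le_mul_right h1 _).trans (le_of_eq ?_)
  ring

/-- If a Bessel potential of `g` is at least one on a ball, then so is, up to a constant, a dyadic
sum of local `L^p` norms of `g`. -/
theorem one_le_tsum_of_isBesselPotential {n : ℕ} {α p : ℝ} (hn : 0 < n) (hα : 0 < α) (hαn : α < n)
    (hp : 1 < p) :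
    ∃ C : ℝ≥0, ∀ f g : EuclideanSpace ℝ (Fin n) → ℝ, IsBesselPotential α p f g →
      ∀ (x : EuclideanSpace ℝ (Fin n)) (t : ℝ≥0), 0 < t →
      (∀ z ∈ Metric.ball x (t : ℝ), 1 ≤ f z) →
      1 ≤ C * ∑' k : ℕ, ((∫⁻ y in Metric.ball x ((2 ^ (k + 1) * t : ℝ≥0) : ℝ), ‖g y‖ₑ ^ p) /
        ballSize n α p (2 ^ (k + 1) * t)) ^ (1 / p) := by
  obtain ⟨C₁, h₁⟩ := lintegral_ball_potential_le hn hα hαn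
  obtain ⟨C₂, h₂⟩ := kernelMass_div_mul_lintegral_ball_le hn hα hp
  refine ⟨C₁ * C₂, fun f g hfg x t ht hf => ?_⟩
  have hg := hfg.1.aestronglyMeasurable
  have ht' : (0 : ℝ) < t := ht
  set v := volume (Metric.ball x (t : ℝ)) with hv
  have hv0 : v ≠ 0 := (Metric.measure_ball_pos _ _ ht').ne'
  have hvt : v ≠ ∞ := measure_ball_lt_top.ne
  set S := ∑' k : ℕ, ((∫⁻ y in Metric.ball x ((2 ^ (k + 1) * t : ℝ≥0) : ℝ), ‖g y‖ₑ ^ p) /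
        ballSize n α p (2 ^ (k + 1) * t)) ^ (1 / p) with hS
  -- Integrating over the ball makes the almost everywhere identity `f = G_α * g` enough. It also
  -- tames the singularity of `G_α`, which is not in the dual Lebesgue space when `αp < n`.
  have e1 : v ≤ ∫⁻ z in Metric.ball x (t : ℝ), ∫⁻ y, ‖besselKernel n α (z - y)‖ₑ * ‖g y‖ₑ := by
    calc v = ∫⁻ z in Metric.ball x (t : ℝ), 1 := by simp [hv]
      _ ≤ _ := by
        refine setLIntegral_mono_ae' Metric.isOpen_ball.measurableSet ?_
        filter_upwards [hfg.2] with z hz hzx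
        have e2 : (1 : ℝ≥0∞) ≤ ‖f z‖ₑ := by
          rw [Real.enorm_of_nonneg (by linarith [hf z hzx])]
          simpa using ENNReal.ofReal_le_ofReal (hf z hzx)
        refine e2.trans ?_
        rw [hz, convolution_def]
        refine (enorm_integral_le_lintegral_enorm _).trans (le_of_eq ?_)
        simp only [ContinuousLinearMap.mul_apply', enorm_mul]
        rw [← lintegral_sub_left_eq_self _ z]
        simp
  have e3 : v ≤ C₁ * v * (C₂ * S) := by
    refine e1.trans ((h₁ g hg x t ht).trans ?_)
    refine mul_le_mul_right ?_ _
    rw [hS, ← ENNReal.tsum_mul_left]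
    exact ENNReal.tsum_le_tsum fun k => h₂ g hg x (2 ^ (k + 1) * t) (by positivity)
  refine (ENNReal.mul_le_mul_iff_right hv0 hvt).1 ?_
  rw [mul_one]
  refine e3.trans (le_of_eq ?_)
  push_cast; ring

/-! ### Discrete consequences of the conditions on `Ψ` -/

theorem exists_le_mul_of_le_mul {Ψ : ℝ≥0 → ℝ≥0}
    (hΨ_incr : ∃ Ψ' : ℝ≥0 → ℝ≥0, StrictMono Ψ' ∧ FunEquiv Ψ Ψ')
    (hΨ_scale : ∀ c : ℝ≥0, 0 < c → FunEquiv (fun s => Ψ (c * s)) Ψ) (c : ℝ≥0) :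
    ∃ C : ℝ≥0, 0 < C ∧ ∀ a b : ℝ≥0, a ≤ c * b → Ψ a ≤ C * Ψ b := by
  obtain ⟨Ψ', hmono, C₁, h₁⟩ := hΨ_incr
  -- `c + 1` because `c` may be `0` and scaling needs a positive factor.
  obtain ⟨C₂, h₂⟩ := hΨ_scale (c + 1) (by positivity)
  refine ⟨C₁ * C₁ * C₂ + 1, by positivity, fun a b hab => ?_⟩
  have hab' : a ≤ (c + 1) * b := hab.trans (by gcongr; simp)
  calc Ψ a ≤ C₁ * Ψ' a := (h₁ a).1
    _ ≤ C₁ * Ψ' ((c + 1) * b) := by gcongr; exact hmono.monotone hab'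
    _ ≤ C₁ * (C₁ * Ψ ((c + 1) * b)) := by gcongr; exact (h₁ _).2
    _ ≤ C₁ * (C₁ * (C₂ * Ψ b)) := by gcongr; exact (h₂ b).1
    _ = C₁ * C₁ * C₂ * Ψ b := by ring
    _ ≤ _ := by gcongr; simp

theorem pos_of_funEquiv_strictMono {Ψ : ℝ≥0 → ℝ≥0}
    (hΨ_incr : ∃ Ψ' : ℝ≥0 → ℝ≥0, StrictMono Ψ' ∧ FunEquiv Ψ Ψ') {a : ℝ≥0} (ha : 0 < a) :
    0 < Ψ a := by
  obtain ⟨Ψ', hmono, C₁, h₁⟩ := hΨ_incr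
  by_contra h
  have h0 : Ψ a = 0 := by simpa using h
  have h2 := (h₁ a).2
  rw [h0, mul_zero] at h2
  exact absurd ((zero_le).trans_lt (hmono ha)) (not_lt.2 h2)

/-- The discrete form of the integral condition on `Ψ`, along sequences of geometric growth. -/
theorem sum_range_rpow_le {Ψ : ℝ≥0 → ℝ≥0} {p : ℝ} (hp : 0 < p)
    (hΨ_incr : ∃ Ψ' : ℝ≥0 → ℝ≥0, StrictMono Ψ' ∧ FunEquiv Ψ Ψ')
    (hΨ_scale : ∀ c : ℝ≥0, 0 < c → FunEquiv (fun s => Ψ (c * s)) Ψ)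
    (hΨ_int : ∃ C : ℝ, ∀ s : ℝ≥0, 0 < s →
      ∫⁻ u in Set.Ioc (0 : ℝ) s, ENNReal.ofReal (((Ψ u.toNNReal : ℝ) / u) ^ (1 / p) / u) ≤
        ENNReal.ofReal (C * ((Ψ s : ℝ) / s) ^ (1 / p))) {lam : ℝ≥0} (hlam : 1 < lam) :
    ∃ C : ℝ≥0, ∀ (A : ℝ≥0) (u : ℕ → ℝ≥0), 0 < A → (∀ k, 0 < u k) →
      (∀ k, lam * u k ≤ u (k + 1)) → ∀ m, (∀ k < m, u k ≤ A) →
      ∑ k ∈ Finset.range m, (Ψ (u k) / u k) ^ (1 / p) ≤ C * (Ψ A / A) ^ (1 / p) := by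
  obtain ⟨C₁, hC₁, h₁⟩ := exists_le_mul_of_le_mul hΨ_incr hΨ_scale 1
  obtain ⟨C₂, hC₂, h₂⟩ := exists_le_mul_of_le_mul hΨ_incr hΨ_scale lam
  obtain ⟨C₃, h₃⟩ := hΨ_int
  set F : ℝ → ℝ≥0∞ := fun u => ENNReal.ofReal (((Ψ u.toNNReal : ℝ) / u) ^ (1 / p) / u) with hF
  have hlam' : (1 : ℝ) < lam := by exact_mod_cast hlam
  have hlam0 : (0 : ℝ) < lam := by linarith
  have hC₁' : (0 : ℝ) < C₁ := hC₁
  have hC₂' : (0 : ℝ) < C₂ := hC₂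
  -- On `(u, lam * u]` the quotient `Ψ(v)/v` is at least `(C₁ lam)⁻¹ Ψ(u)/u`, and the integral of
  -- `dv/v` is at least `(lam - 1)/lam`.
  set c : ℝ := ((C₁ : ℝ) * lam)⁻¹ ^ (1 / p) * ((lam - 1) / lam) with hc
  have hc0 : 0 < c := by
    have : (0 : ℝ) < lam - 1 := by linarith
    positivity
  have low : ∀ u : ℝ≥0, 0 < u → ENNReal.ofReal (c * ((Ψ u : ℝ) / u) ^ (1 / p)) ≤
      ∫⁻ v in Set.Ioc (u : ℝ) (lam * u), F v := by
    intro u hu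
    have hu' : (0 : ℝ) < u := hu
    have e : ENNReal.ofReal (c * ((Ψ u : ℝ) / u) ^ (1 / p)) =
        ∫⁻ v in Set.Ioc (u : ℝ) (lam * u),
          ENNReal.ofReal ((((Ψ u : ℝ) / u) * ((C₁ : ℝ) * lam)⁻¹) ^ (1 / p) / (lam * u)) := by
      rw [setLIntegral_const, Real.volume_Ioc, ← ENNReal.ofReal_mul (by positivity),
        Real.mul_rpow (by positivity) (by positivity), hc]
      congr 1
      field_simp
    rw [e]
    refine setLIntegral_mono_ae' measurableSet_Ioc (Filter.Eventually.of_forall fun v hv => ?_)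
    have hv0 : 0 < v := hu'.trans hv.1
    refine ENNReal.ofReal_le_ofReal ?_
    have h4 : (Ψ u : ℝ) ≤ C₁ * Ψ v.toNNReal := by
      have := h₁ u v.toNNReal (by
        rw [one_mul]; exact NNReal.le_toNNReal_of_coe_le hv.1.le)
      exact_mod_cast this
    have h5 : (Ψ u : ℝ) / u * ((C₁ : ℝ) * lam)⁻¹ ≤ Ψ v.toNNReal / v := by
      rw [← div_eq_mul_inv, div_div, div_le_div_iff₀ (by positivity) hv0]
      calc (Ψ u : ℝ) * v ≤ (C₁ * Ψ v.toNNReal) * (lam * u) := by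
            gcongr; exact hv.2
        _ = _ := by ring
    gcongr
    exact hv.2
  refine ⟨Real.toNNReal (C₃ * (C₂ : ℝ) ^ (1 / p) / c), fun A u hA hu hgrow m hm => ?_⟩
  have hA' : (0 : ℝ) < A := hA
  have hmono : Monotone u := monotone_nat_of_le_succ fun k =>
    (le_mul_of_one_le_left (zero_le) hlam.le).trans (hgrow k)
  have hdisj : (↑(Finset.range m) : Set ℕ).PairwiseDisjoint
      fun k => Set.Ioc (u k : ℝ) (lam * u k) := by
    have aux : ∀ i j : ℕ, i < j →
        Disjoint (Set.Ioc (u i : ℝ) (lam * u i)) (Set.Ioc (u j : ℝ) (lam * u j)) := by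
      intro i j hij
      refine Set.disjoint_left.2 fun v hv hv' => ?_
      have h6 : lam * u i ≤ u j := (hgrow i).trans (hmono hij)
      have h7 : (lam : ℝ) * u i ≤ u j := by exact_mod_cast h6
      linarith [hv.2, hv'.1]
    intro i _ j _ hij
    rcases lt_or_gt_of_ne hij with h | h
    · exact aux i j h
    · exact (aux j i h).symm
  -- The intervals `(u k, lam * u k]` are disjoint by the growth of `u`. The last one may pass `A`,
  -- so the integral condition is used at `lam * A`.
  have key : ENNReal.ofReal (∑ k ∈ Finset.range m, c * ((Ψ (u k) : ℝ) / u k) ^ (1 / p)) ≤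
      ENNReal.ofReal (C₃ * ((Ψ (lam * A) : ℝ) / (lam * A : ℝ≥0)) ^ (1 / p)) := by
    rw [ENNReal.ofReal_sum_of_nonneg (fun k _ => by positivity)]
    calc _ ≤ ∑ k ∈ Finset.range m, ∫⁻ v in Set.Ioc (u k : ℝ) (lam * u k), F v :=
          Finset.sum_le_sum fun k _ => low (u k) (hu k)
      _ = ∫⁻ v in ⋃ k ∈ Finset.range m, Set.Ioc (u k : ℝ) (lam * u k), F v :=
          (lintegral_biUnion_finset hdisj (fun _ _ => measurableSet_Ioc) F).symm
      _ ≤ ∫⁻ v in Set.Ioc (0 : ℝ) ((lam * A : ℝ≥0) : ℝ), F v := by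
          refine lintegral_mono_set (Set.iUnion₂_subset fun k hk => ?_)
          refine Set.Ioc_subset_Ioc (NNReal.coe_nonneg _) ?_
          rw [NNReal.coe_mul]
          gcongr
          exact_mod_cast hm k (Finset.mem_range.1 hk)
      _ ≤ _ := h₃ _ (by positivity)
  have hX : 0 ≤ ((Ψ (lam * A) : ℝ) / (lam * A : ℝ≥0)) ^ (1 / p) := by positivity
  have hS : 0 ≤ ∑ k ∈ Finset.range m, ((Ψ (u k) : ℝ) / u k) ^ (1 / p) := by positivity
  have hY : ((Ψ (lam * A) : ℝ) / (lam * A : ℝ≥0)) ^ (1 / p) ≤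
      (C₂ : ℝ) ^ (1 / p) * ((Ψ A : ℝ) / A) ^ (1 / p) := by
    rw [← Real.mul_rpow (by positivity) (by positivity)]
    refine Real.rpow_le_rpow (by positivity) ?_ (by positivity)
    rw [← mul_div_assoc, NNReal.coe_mul]
    have : (Ψ (lam * A) : ℝ) ≤ C₂ * Ψ A := by exact_mod_cast h₂ (lam * A) A le_rfl
    gcongr
    exact le_mul_of_one_le_left hA'.le hlam'.le
  have goal : ∑ k ∈ Finset.range m, ((Ψ (u k) : ℝ) / u k) ^ (1 / p) ≤
      max (C₃ * (C₂ : ℝ) ^ (1 / p) / c) 0 * ((Ψ A : ℝ) / A) ^ (1 / p) := by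
    rw [← Finset.mul_sum] at key
    have hZ : 0 ≤ ((Ψ A : ℝ) / A) ^ (1 / p) := by positivity
    -- The given constant is an arbitrary real; if it is not positive, `ENNReal.ofReal` truncates
    -- the bound to zero.
    rcases le_or_gt C₃ 0 with h | h
    · rw [ENNReal.ofReal_of_nonpos (mul_nonpos_of_nonpos_of_nonneg h hX), nonpos_iff_eq_zero,
        ENNReal.ofReal_eq_zero] at key
      have : ∑ k ∈ Finset.range m, ((Ψ (u k) : ℝ) / u k) ^ (1 / p) ≤ 0 := by
        by_contra hcon
        exact absurd key (not_le.2 (mul_pos hc0 (not_le.1 hcon)))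
      exact this.trans (by positivity)
    · rw [ENNReal.ofReal_le_ofReal_iff (by positivity)] at key
      rw [max_eq_left (by positivity), div_mul_eq_mul_div, le_div_iff₀ hc0, mul_comm]
      refine key.trans ?_
      rw [mul_assoc]
      gcongr
  rw [← NNReal.coe_le_coe]
  push_cast [Real.coe_toNNReal']
  exact goal

theorem tsum_div_rpow_le_of_geometric {p : ℝ} (hp : 0 < p) {lam : ℝ≥0} (hlam : 1 < lam) :
    ∃ C : ℝ≥0, ∀ (N : ℝ≥0∞) (B : ℝ≥0) (u : ℕ → ℝ≥0), B ≤ u 0 → (∀ k, lam * u k ≤ u (k + 1)) →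
      ∑' k, (N / u k) ^ (1 / p) ≤ C * (N / B) ^ (1 / p) := by
  have hlam0 : 0 < lam := one_pos.trans hlam
  set ρ : ℝ≥0 := lam⁻¹ ^ (1 / p) with hρ
  have hρ1 : ρ < 1 := NNReal.rpow_lt_one (inv_lt_one_of_one_lt₀ hlam) (by positivity)
  refine ⟨(1 - ρ)⁻¹, fun N B u hB hgrow => ?_⟩
  have hu : ∀ k, lam ^ k * B ≤ u k := by
    intro k
    induction k with
    | zero => simpa using hB
    | succ k ih =>
      calc lam ^ (k + 1) * B = lam * (lam ^ k * B) := by ring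
        _ ≤ lam * u k := by gcongr
        _ ≤ _ := hgrow k
  have h1 : ∀ k, (N / u k) ^ (1 / p) ≤ (N / B) ^ (1 / p) * (ρ : ℝ≥0∞) ^ k := by
    intro k
    have e : (ρ : ℝ≥0∞) ^ k = (((lam ^ k : ℝ≥0) : ℝ≥0∞)⁻¹) ^ (1 / p) := by
      rw [hρ, ← ENNReal.coe_inv (by positivity), ← ENNReal.coe_rpow_of_nonneg _ (by positivity),
        ← ENNReal.coe_pow, ← inv_pow, ← NNReal.rpow_natCast, ← NNReal.rpow_mul, mul_comm,
        NNReal.rpow_mul, NNReal.rpow_natCast]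
    rw [e, ← ENNReal.mul_rpow_of_nonneg _ _ (by positivity)]
    refine ENNReal.rpow_le_rpow ?_ (by positivity)
    rw [← div_eq_mul_inv, ENNReal.div_eq_inv_mul, ENNReal.div_eq_inv_mul (a := N / B),
      ENNReal.div_eq_inv_mul (a := N), ← mul_assoc, ← ENNReal.mul_inv (by simp) (by simp)]
    gcongr
    exact_mod_cast hu k
  calc _ ≤ ∑' k, (N / B) ^ (1 / p) * (ρ : ℝ≥0∞) ^ k := ENNReal.tsum_le_tsum h1
    _ = (N / B) ^ (1 / p) * (1 - (ρ : ℝ≥0∞))⁻¹ := by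
      rw [ENNReal.tsum_mul_left, ENNReal.tsum_geometric]
    _ = _ := by
      rw [mul_comm, ENNReal.coe_inv (tsub_pos_of_lt hρ1).ne', ENNReal.coe_sub, ENNReal.coe_one]

/-- If a sum of normalized masses `M k / u k` along a geometric sequence `u` is bounded below, then
one of the masses is large in terms of `Ψ`. -/
theorem exists_large_mass {Ψ : ℝ≥0 → ℝ≥0} {p : ℝ} (hp : 0 < p)
    (hΨ_incr : ∃ Ψ' : ℝ≥0 → ℝ≥0, StrictMono Ψ' ∧ FunEquiv Ψ Ψ')
    (hΨ_scale : ∀ c : ℝ≥0, 0 < c → FunEquiv (fun s => Ψ (c * s)) Ψ)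
    (hΨ_int : ∃ C : ℝ, ∀ s : ℝ≥0, 0 < s →
      ∫⁻ u in Set.Ioc (0 : ℝ) s, ENNReal.ofReal (((Ψ u.toNNReal : ℝ) / u) ^ (1 / p) / u) ≤
        ENNReal.ofReal (C * ((Ψ s : ℝ) / s) ^ (1 / p))) {lam : ℝ≥0} (hlam : 1 < lam) (C₀ : ℝ≥0) :
    ∃ K D : ℝ≥0, 1 ≤ K ∧ ∀ (A : ℝ≥0) (u : ℕ → ℝ≥0) (M : ℕ → ℝ≥0∞) (N : ℝ≥0∞), 0 < A →
      (∀ k, 0 < u k) → (∀ k, lam * u k ≤ u (k + 1)) → (∀ k, M k ≤ N) → K * N ≤ A →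
      1 ≤ C₀ * ∑' k, (M k / u k) ^ (1 / p) →
      ∃ k, u k ≤ A ∧ A * Ψ (u k) ≤ D * Ψ A * M k := by
  obtain ⟨C₁, h₁⟩ := sum_range_rpow_le hp hΨ_incr hΨ_scale hΨ_int hlam
  obtain ⟨C₃, h₃⟩ := tsum_div_rpow_le_of_geometric hp hlam
  have hroot : ∀ a : ℝ≥0, ((a ^ p)⁻¹) ^ (1 / p) = a⁻¹ := fun a => by
    rw [NNReal.inv_rpow, ← NNReal.rpow_mul, mul_one_div_cancel hp.ne', NNReal.rpow_one]
  -- `d` and `e` make the head and the tail of the sum, multiplied by `C₀`, at most `1/4` each,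
  -- contradicting the lower bound 1.
  set d := 4 * (C₀ * C₁ + 1) with hd
  set e := 4 * (C₀ * C₃ + 1) with he
  have hd0 : 0 < d := by positivity
  have he0 : 0 < e := by positivity
  have he1 : 1 ≤ e := by
    rw [he]
    calc (1 : ℝ≥0) ≤ 4 * 1 := by norm_num
      _ ≤ _ := by gcongr; simp
  have hK : 1 ≤ e ^ p := NNReal.one_le_rpow he1 hp.le
  refine ⟨e ^ p, d ^ p, hK, fun A u M N hA hu hgrow hMN hKN hone => ?_⟩
  have hK0 : 0 < e ^ p := one_pos.trans_le hK
  have hD0 : 0 < d ^ p := NNReal.rpow_pos hd0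
  have hN : N / A ≤ ((e ^ p)⁻¹ : ℝ≥0) := by
    rw [ENNReal.div_le_iff (by simpa using hA.ne') (by simp), ENNReal.coe_inv hK0.ne',
      mul_comm, ← div_eq_mul_inv, ENNReal.le_div_iff_mul_le (by simp [hK0.ne']) (by simp),
      mul_comm]
    exact hKN
  have hNtop : N ≠ ∞ := by
    rintro rfl
    rw [ENNReal.mul_top (by simpa using hK0.ne')] at hKN
    simp at hKN
  have hΨA := pos_of_funEquiv_strictMono hΨ_incr hA
  by_contra! hcon
  have hlt : ∃ k, A < u k := by
    obtain ⟨m, hm⟩ := pow_unbounded_of_one_lt (A / u 0) hlam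
    refine ⟨m, ?_⟩
    have hum : ∀ k, lam ^ k * u 0 ≤ u k := by
      intro k
      induction k with
      | zero => simp
      | succ k ih =>
        calc lam ^ (k + 1) * u 0 = lam * (lam ^ k * u 0) := by ring
          _ ≤ lam * u k := by gcongr
          _ ≤ _ := hgrow k
    exact ((div_lt_iff₀ (hu 0)).1 hm).trans_le (hum m)
  classical
  -- The sum is cut at the first `m` with `u m > A`. Before it, the failed inequality and the
  -- discrete integral condition apply; from it on, `M k ≤ N ≤ A / e^p` and geometric decay.
  obtain ⟨m, hm, hmin⟩ : ∃ m, A < u m ∧ ∀ k < m, u k ≤ A :=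
    ⟨Nat.find hlt, Nat.find_spec hlt, fun k hk => not_lt.1 (Nat.find_min hlt hk)⟩
  set X := (Ψ A / A) ^ (1 / p) with hX
  have hX0 : 0 < X := NNReal.rpow_pos (by positivity)
  have hhead : ∑ k ∈ Finset.range m, (M k / u k) ^ (1 / p) ≤ ((d⁻¹ * C₁ : ℝ≥0) : ℝ≥0∞) := by
    calc ∑ k ∈ Finset.range m, (M k / u k) ^ (1 / p)
        ≤ ∑ k ∈ Finset.range m, ((d⁻¹ * (X⁻¹ * (Ψ (u k) / u k) ^ (1 / p)) : ℝ≥0) : ℝ≥0∞) := by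
          refine Finset.sum_le_sum fun k hk => ?_
          have hk' := (hcon k (hmin k (Finset.mem_range.1 hk))).le
          obtain ⟨w, hw⟩ : ∃ w : ℝ≥0, (w : ℝ≥0∞) = M k :=
            ⟨_, ENNReal.coe_toNNReal (ne_top_of_le_ne_top hNtop (hMN k))⟩
          rw [← hw] at hk' ⊢
          norm_cast at hk'
          rw [← ENNReal.coe_div (hu k).ne', ← ENNReal.coe_rpow_of_nonneg _ (by positivity),
            ENNReal.coe_le_coe, ← hroot d, hX, ← NNReal.inv_rpow (Ψ A / A), ← NNReal.mul_rpow,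
            ← NNReal.mul_rpow]
          refine NNReal.rpow_le_rpow ?_ (by positivity)
          have huk := hu k
          calc w / u k = (d ^ p)⁻¹ * (Ψ A)⁻¹ * (d ^ p * Ψ A * w) / u k := by field_simp
            _ ≤ (d ^ p)⁻¹ * (Ψ A)⁻¹ * (A * Ψ (u k)) / u k := by gcongr
            _ = _ := by field_simp
      _ = ((d⁻¹ * (X⁻¹ * ∑ k ∈ Finset.range m, (Ψ (u k) / u k) ^ (1 / p)) : ℝ≥0) : ℝ≥0∞) := by
          rw [← ENNReal.ofNNReal_finsetSum, Finset.mul_sum, Finset.mul_sum]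
      _ ≤ ((d⁻¹ * (X⁻¹ * (C₁ * X)) : ℝ≥0) : ℝ≥0∞) := by
          rw [ENNReal.coe_le_coe]
          gcongr
          exact h₁ A u hA hu hgrow m hmin
      _ = _ := by congr 1; field_simp
  have htail : ∑' k, (M (k + m) / u (k + m)) ^ (1 / p) ≤ ((e⁻¹ * C₃ : ℝ≥0) : ℝ≥0∞) := by
    calc ∑' k, (M (k + m) / u (k + m)) ^ (1 / p)
        ≤ ∑' k, (N / u (k + m)) ^ (1 / p) := by
          gcongr; exact hMN _
      _ ≤ C₃ * (N / A) ^ (1 / p) :=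
          h₃ N A (fun k => u (k + m)) (by simpa using hm.le) fun k => by
            have := hgrow (k + m)
            rwa [add_right_comm] at this
      _ ≤ C₃ * (((e ^ p)⁻¹ : ℝ≥0) : ℝ≥0∞) ^ (1 / p) := by gcongr
      _ = _ := by
        rw [← ENNReal.coe_rpow_of_nonneg _ (by positivity), hroot, mul_comm, ENNReal.coe_mul]
  have hall : (1 : ℝ≥0∞) ≤ ((C₀ * (d⁻¹ * C₁ + e⁻¹ * C₃) : ℝ≥0) : ℝ≥0∞) := by
    refine hone.trans ?_
    rw [← ENNReal.summable.sum_add_tsum_nat_add' (k := m), ENNReal.coe_mul, ENNReal.coe_add]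
    gcongr
  have hall' : (1 : ℝ≥0) ≤ C₀ * (d⁻¹ * C₁ + e⁻¹ * C₃) := by exact_mod_cast hall
  have h5 : C₀ * (d⁻¹ * C₁) ≤ 1 / 4 := by
    have : C₀ * (d⁻¹ * C₁) = (C₀ * C₁) / d := by field_simp
    rw [this, div_le_iff₀ hd0, hd]
    calc C₀ * C₁ ≤ C₀ * C₁ + 1 := by simp
      _ = _ := by ring
  have h6 : C₀ * (e⁻¹ * C₃) ≤ 1 / 4 := by
    have : C₀ * (e⁻¹ * C₃) = (C₀ * C₃) / e := by field_simp
    rw [this, div_le_iff₀ he0, he]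
    calc C₀ * C₃ ≤ C₀ * C₃ + 1 := by simp
      _ = _ := by ring
  rw [mul_add] at hall'
  have h7 : (1 : ℝ≥0) ≤ 1 / 4 + 1 / 4 := hall'.trans (add_le_add h5 h6)
  have h8 : (1 : ℝ) ≤ 1 / 4 + 1 / 4 := by exact_mod_cast h7
  norm_num at h8

/-! ### Tents, balls and the covering argument -/

/-- A ball is connected, so one that meets `O` but not its boundary lies in `O`. -/
theorem ball_subset_of_mem_tent {n : ℕ} {O : Set (EuclideanSpace ℝ (Fin n))} (hO : IsOpen O)
    {z : HalfSpace n} (hz : z ∈ tent O) : Metric.ball z.1 (z.2 : ℝ) ⊆ O := by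
  have ht : (0 : ℝ) < z.2 := z.2.2
  refine (convex_ball z.1 (z.2 : ℝ)).isPreconnected.subset_left_of_subset_union hO
    isClosed_closure.isOpen_compl (Set.disjoint_compl_right_iff_subset.2 subset_closure)
    (fun w hw => ?_)
    ⟨z.1, Metric.mem_ball_self ht, hz.1⟩
  by_contra hcon
  rw [Set.mem_union, not_or, Set.mem_compl_iff, not_not] at hcon
  have hwf : w ∈ frontier O := by
    rw [hO.frontier_eq]; exact ⟨hcon.2, hcon.1⟩
  have h1 := hz.2.trans_le (Metric.infEDist_le_edist_of_mem hwf)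
  rw [edist_dist] at h1
  have h2 : dist z.1 w < z.2 := by rw [dist_comm]; exact hw
  exact absurd (ENNReal.ofReal_le_ofReal h2.le) (not_le.2 h1)

theorem mem_tent_ball {n : ℕ} {x : EuclideanSpace ℝ (Fin n)} {R : ℝ} {z : HalfSpace n}
    (h : dist z.1 x + z.2 < R) : z ∈ tent (Metric.ball x R) := by
  have ht : (0 : ℝ) < z.2 := z.2.2
  have hd := dist_nonneg (x := z.1) (y := x)
  refine ⟨by rw [Metric.mem_ball]; linarith, ?_⟩
  rw [frontier_ball x (by linarith)]
  refine lt_of_lt_of_le (b := ENNReal.ofReal (R - dist z.1 x))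
    ((ENNReal.ofReal_lt_ofReal_iff (by linarith)).2 (by linarith)) ?_
  refine Metric.le_infEDist.2 fun y hy => ?_
  rw [edist_dist]
  refine ENNReal.ofReal_le_ofReal ?_
  rw [Metric.mem_sphere] at hy
  linarith [dist_triangle y z.1 x, dist_comm y z.1]

/-- Test the inclusion at the point of the smaller ball farthest from `y`. This turns the inclusion
from the Vitali lemma into an inequality for centres and radii. -/
theorem radius_le_of_closedBall_subset {n : ℕ} (hn : 0 < n) {x y : EuclideanSpace ℝ (Fin n)}
    {r s : ℝ} (hr : 0 ≤ r) (h : Metric.closedBall x r ⊆ Metric.closedBall y s) :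
    dist x y + r ≤ s := by
  have : Nonempty (Fin n) := ⟨⟨0, hn⟩⟩
  obtain ⟨v, hv, hvxy⟩ : ∃ v : EuclideanSpace ℝ (Fin n), ‖v‖ = 1 ∧ x - y = ‖x - y‖ • v := by
    rcases eq_or_ne x y with rfl | hne
    · obtain ⟨v, hv⟩ := exists_norm_eq (EuclideanSpace ℝ (Fin n)) (zero_le_one (α := ℝ))
      exact ⟨v, hv, by simp⟩
    · have h0 : ‖x - y‖ ≠ 0 := norm_ne_zero_iff.2 (sub_ne_zero.2 hne)
      refine ⟨‖x - y‖⁻¹ • (x - y), ?_, ?_⟩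
      · rw [norm_smul, norm_inv, norm_norm, inv_mul_cancel₀ h0]
      · rw [smul_smul, mul_inv_cancel₀ h0, one_smul]
  have h1 := h (show x + r • v ∈ Metric.closedBall x r by
    rw [mem_closedBall_iff_norm, add_sub_cancel_left, norm_smul, hv, mul_one,
      Real.norm_of_nonneg hr])
  rw [mem_closedBall_iff_norm] at h1
  have h2 : x + r • v - y = (‖x - y‖ + r) • v := by
    rw [add_smul, ← hvxy]; abel
  rw [h2, norm_smul, hv, mul_one, Real.norm_of_nonneg (by positivity)] at h1
  rwa [dist_eq_norm]

/-- Dyadic radii give sizes of geometric growth; the ratio exceeds 1 exactly when `αp < n`. -/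
theorem mul_ballSize_le {n : ℕ} {α p : ℝ} (hα : 0 < α) (hp : 0 < p) (r : ℝ≥0) :
    (2 : ℝ≥0) ^ ((n : ℝ) - α * p) * ballSize n α p r ≤ ballSize n α p (2 * r) := by
  have hm := mul_pos hα hp
  unfold ballSize
  rw [mul_max]
  refine max_le_max (le_of_eq (NNReal.mul_rpow).symm) ?_
  rw [mul_pow]
  gcongr
  rw [← NNReal.rpow_natCast]
  exact NNReal.rpow_le_rpow_of_exponent_le (by norm_num) (by linarith)

theorem ballSize_mul_le {n : ℕ} {α p : ℝ} (hα : 0 < α) (hp : 0 < p) {c : ℝ≥0} (hc : 1 ≤ c)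
    (r : ℝ≥0) : ballSize n α p (c * r) ≤ c ^ n * ballSize n α p r := by
  have hm := mul_pos hα hp
  unfold ballSize
  rw [mul_max]
  refine max_le_max ?_ (le_of_eq (mul_pow _ _ _))
  rw [NNReal.mul_rpow]
  gcongr
  rw [← NNReal.rpow_natCast]
  exact NNReal.rpow_le_rpow_of_exponent_le hc (by linarith)

/-- Supplies the uniform bound on radii that the Vitali lemma requires. -/
theorem le_max_of_ballSize_le {n : ℕ} {α p : ℝ} (hn : 0 < n) {r A : ℝ≥0}
    (h : ballSize n α p r ≤ A) : r ≤ max 1 A := by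
  rcases le_total r 1 with h1 | h1
  · exact le_max_of_le_left h1
  · exact le_max_of_le_right
      ((le_self_pow₀ h1 hn.ne').trans ((le_max_right _ _).trans h))

/-- The capacitary estimate: if `G_α * g ≥ 1` on `O`, then the measure of the tent over `O` is
controlled by `Ψ` at the `p`-th power of the norm of `g`. -/
theorem measure_tent_le {n : ℕ} {α p : ℝ} (hn : 0 < n) (hα : 0 < α) (hαn : α < n) (hp : 1 < p)
    (hαp : α * p < n) {Ψ : ℝ≥0 → ℝ≥0}
    (hΨ_incr : ∃ Ψ' : ℝ≥0 → ℝ≥0, StrictMono Ψ' ∧ FunEquiv Ψ Ψ')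
    (hΨ_scale : ∀ c : ℝ≥0, 0 < c → FunEquiv (fun s => Ψ (c * s)) Ψ)
    (hΨ_int : ∃ C : ℝ, ∀ s : ℝ≥0, 0 < s →
      ∫⁻ u in Set.Ioc (0 : ℝ) s, ENNReal.ofReal (((Ψ u.toNNReal : ℝ) / u) ^ (1 / p) / u) ≤
        ENNReal.ofReal (C * ((Ψ s : ℝ) / s) ^ (1 / p)))
    {μ : Measure (HalfSpace n)} (hμ : μ ∈ carlesonClass n (psiAlpha n α p Ψ)) :
    ∃ K C : ℝ≥0, 1 ≤ K ∧ ∀ (O : Set (EuclideanSpace ℝ (Fin n)))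
      (f g : EuclideanSpace ℝ (Fin n) → ℝ) (A : ℝ≥0), IsOpen O → IsBesselPotential α p f g →
      (∀ x ∈ O, 1 ≤ f x) → 0 < A → K * ∫⁻ y, ‖g y‖ₑ ^ p ≤ A → μ (tent O) ≤ C * Ψ A := by
  have hp0 : 0 < p := by linarith
  obtain ⟨Cμ, hμ⟩ := hμ
  obtain ⟨C₀, h₀⟩ := one_le_tsum_of_isBesselPotential hn hα hαn hp
  have hlam : 1 < (2 : ℝ≥0) ^ ((n : ℝ) - α * p) :=
    NNReal.one_lt_rpow (by norm_num) (by linarith)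
  obtain ⟨K, D, hK, h₁⟩ := exists_large_mass hp0 hΨ_incr hΨ_scale hΨ_int hlam C₀
  obtain ⟨C₁, hC₁, h₂⟩ := exists_le_mul_of_le_mul hΨ_incr hΨ_scale (11 ^ n)
  refine ⟨K, Cμ * C₁ * D, hK, fun O f g A hO hfg hf hA hKA => ?_⟩
  set N := ∫⁻ y, ‖g y‖ₑ ^ p with hN
  have hNA : N ≤ A := (le_mul_of_one_le_left (zero_le) (by exact_mod_cast hK)).trans hKA
  have hsel : ∀ z : HalfSpace n, z ∈ tent O → ∃ r : ℝ≥0, (z.2 : ℝ) ≤ r ∧ ballSize n α p r ≤ A ∧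
      A * Ψ (ballSize n α p r) ≤ D * Ψ A * ∫⁻ y in Metric.ball z.1 (r : ℝ), ‖g y‖ₑ ^ p := by
    intro z hz
    have ht : (0 : ℝ) < z.2 := z.2.2
    set t : ℝ≥0 := ⟨z.2, ht.le⟩ with htdef
    have ht0 : 0 < t := ht
    have hball := ball_subset_of_mem_tent hO hz
    obtain ⟨k, hk1, hk2⟩ := h₁ A (fun k => ballSize n α p (2 ^ (k + 1) * t))
      (fun k => ∫⁻ y in Metric.ball z.1 ((2 ^ (k + 1) * t : ℝ≥0) : ℝ), ‖g y‖ₑ ^ p) N hA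
      (fun k => ballSize_pos (by positivity))
      (fun k => (mul_ballSize_le hα hp0 _).trans (le_of_eq (by congr 1; ring)))
      (fun k => setLIntegral_le_lintegral _ _) hKA
      (h₀ f g hfg z.1 t ht0 fun w hw => hf w (hball hw))
    refine ⟨2 ^ (k + 1) * t, ?_, hk1, hk2⟩
    have h3 : t ≤ 2 ^ (k + 1) * t :=
      le_mul_of_one_le_left (zero_le) (one_le_pow₀ one_le_two)
    exact_mod_cast h3
  choose! r hr1 hr2 hr3 using hsel
  have hrpos : ∀ z ∈ tent O, 0 < r z := fun z hz => by
    have h4 : (0 : ℝ) < r z := lt_of_lt_of_le z.2.2 (hr1 z hz)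
    exact h4
  obtain ⟨U, hUO, hUd, hUc⟩ := Vitali.exists_disjoint_subfamily_covering_enlargement_closedBall
    (tent O) (fun z => z.1) (fun z => (r z : ℝ)) ((max 1 A : ℝ≥0) : ℝ)
    (fun z hz => by exact_mod_cast le_max_of_ballSize_le hn (hr2 z hz)) 5 (by norm_num)
  have hUcount : U.Countable := hUd.countable_of_nonempty_interior fun z hz =>
    ⟨z.1, Metric.ball_subset_interior_closedBall
      (Metric.mem_ball_self (NNReal.coe_pos.2 (hrpos z (hUO hz))))⟩
  -- The selection gives `dist z.1 b.1 + r z ≤ 5 * r b`, and `z.2 ≤ r z`. Any dilation factor above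
  -- 5 would serve; 11 is generous.
  have hcover : tent O ⊆ ⋃ b ∈ U, tent (Metric.ball b.1 ((11 * r b : ℝ≥0) : ℝ)) := by
    intro z hz
    obtain ⟨b, hb, hsub⟩ := hUc z hz
    refine Set.mem_iUnion₂.2 ⟨b, hb, mem_tent_ball ?_⟩
    have h5 := radius_le_of_closedBall_subset hn (NNReal.coe_nonneg _) hsub
    have h6 : (0 : ℝ) < r b := hrpos b (hUO hb)
    have h7 := hr1 z hz
    push_cast
    linarith
  have hmass : ∑' b : U, ∫⁻ y in Metric.ball b.1.1 (r b.1 : ℝ), ‖g y‖ₑ ^ p ≤ N := by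
    rw [← lintegral_biUnion (s := fun b : HalfSpace n => Metric.ball b.1 (r b : ℝ)) hUcount
      (fun _ _ => Metric.isOpen_ball.measurableSet)
      (hUd.mono fun b => Metric.ball_subset_closedBall)]
    exact setLIntegral_le_lintegral _ _
  have htent : ∀ b ∈ U, μ (tent (Metric.ball b.1 ((11 * r b : ℝ≥0) : ℝ))) ≤
      Cμ * C₁ * Ψ (ballSize n α p (r b)) := by
    intro b hb
    have h8 := hrpos b (hUO hb)
    have h9 : (0 : ℝ≥0) < 11 * r b := by positivity
    refine (hμ b.1 (11 * r b) h9).trans ?_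
    rw [psiAlpha_eq hα hp0 Ψ h9, mul_assoc]
    gcongr
    exact_mod_cast h₂ _ _ (ballSize_mul_le hα hp0 (by norm_num) (r b))
  -- The estimate is proved after multiplication by `A`, since the selected balls satisfy `A Ψ(β(r))
  -- ≤ D Ψ(A) ∫ |g|^p`; the disjoint masses add up to at most `N ≤ A`.
  have hAe : (A : ℝ≥0∞) ≠ 0 := by simpa using hA.ne'
  refine (ENNReal.mul_le_mul_iff_right hAe ENNReal.coe_ne_top).1 ?_
  calc (A : ℝ≥0∞) * μ (tent O)
      ≤ A * ∑' b : U, μ (tent (Metric.ball b.1.1 ((11 * r b.1 : ℝ≥0) : ℝ))) := by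
        gcongr
        exact (measure_mono hcover).trans (measure_biUnion_le μ hUcount _)
    _ = ∑' b : U, A * μ (tent (Metric.ball b.1.1 ((11 * r b.1 : ℝ≥0) : ℝ))) :=
        ENNReal.tsum_mul_left.symm
    _ ≤ ∑' b : U, (Cμ * C₁ * D * Ψ A : ℝ≥0∞) *
          ∫⁻ y in Metric.ball b.1.1 (r b.1 : ℝ), ‖g y‖ₑ ^ p := by
        refine ENNReal.tsum_le_tsum fun b => ?_
        calc (A : ℝ≥0∞) * μ (tent (Metric.ball b.1.1 ((11 * r b.1 : ℝ≥0) : ℝ)))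
            ≤ A * (Cμ * C₁ * Ψ (ballSize n α p (r b.1))) := by gcongr; exact htent b.1 b.2
          _ = Cμ * C₁ * (A * Ψ (ballSize n α p (r b.1))) := by ring
          _ ≤ Cμ * C₁ * (D * Ψ A * ∫⁻ y in Metric.ball b.1.1 (r b.1 : ℝ), ‖g y‖ₑ ^ p) := by
              exact mul_le_mul_right (hr3 b.1 (hUO b.2)) _
          _ = _ := by ring
    _ = (Cμ * C₁ * D * Ψ A : ℝ≥0∞) *
          ∑' b : U, ∫⁻ y in Metric.ball b.1.1 (r b.1 : ℝ), ‖g y‖ₑ ^ p := ENNReal.tsum_mul_left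
    _ ≤ (Cμ * C₁ * D * Ψ A : ℝ≥0∞) * A := by gcongr; exact hmass.trans hNA
    _ = _ := by push_cast; ring

/-! ### Conclusion -/

theorem exists_isBesselPotential_of_besselCap_lt {n : ℕ} {α p : ℝ} (hp : 0 < p)
    {O : Set (EuclideanSpace ℝ (Fin n))} {a : ℝ≥0∞} (h : besselCap α p O < a) :
    ∃ f g : EuclideanSpace ℝ (Fin n) → ℝ, IsBesselPotential α p f g ∧ (∀ x ∈ O, 1 ≤ f x) ∧
      ∫⁻ y, ‖g y‖ₑ ^ p < a := by
  simp only [besselCap, iInf_lt_iff] at h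
  obtain ⟨f, _, hf1, hlt⟩ := h
  rw [← ENNReal.lt_rpow_inv_iff hp] at hlt
  simp only [besselNorm, iInf_lt_iff] at hlt
  obtain ⟨g, hg, hlt⟩ := hlt
  refine ⟨f, g, hg, hf1, ?_⟩
  rwa [ENNReal.lt_rpow_inv_iff hp, eLpNorm_ofReal_rpow hp] at hlt

theorem mainTheorem4 (n : ℕ) (α p : ℝ) (hα : 0 < α) (hp : 1 < p) (hpn : p < n / α)
    (Ψ : ℝ≥0 → ℝ≥0)
    (hΨ_onto : Function.Surjective Ψ)
    (hΨ_incr : ∃ Ψ' : ℝ≥0 → ℝ≥0, StrictMono Ψ' ∧ FunEquiv Ψ Ψ')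
    (hΨ_zero : Ψ 0 = 0)
    (hΨ_scale : ∀ c : ℝ≥0, 0 < c → FunEquiv (fun s => Ψ (c * s)) Ψ)
    (hΨ_int : ∃ C : ℝ, ∀ s : ℝ≥0, 0 < s →
      ∫⁻ u in Set.Ioc (0 : ℝ) s, ENNReal.ofReal (((Ψ u.toNNReal : ℝ) / u) ^ (1 / p) / u) ≤
        ENNReal.ofReal (C * ((Ψ s : ℝ) / s) ^ (1 / p))) :
    capClass n α p Ψ = carlesonClass n (psiAlpha n α p Ψ) := by
  have hp0 : 0 < p := by linarith
  have hαp : α * p < n := by rw [lt_div_iff₀ hα] at hpn; linarith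
  have hαn : α < n := by nlinarith
  have hn : 0 < n := by
    have : (0 : ℝ) < n := hα.trans hαn
    exact_mod_cast this
  apply Set.Subset.antisymm
  · rintro μ ⟨C, hC⟩
    obtain ⟨C₁, h₁⟩ := besselCap_ball_le hn hα hαn hp0
    obtain ⟨C₂, -, h₂⟩ := exists_le_mul_of_le_mul hΨ_incr hΨ_scale C₁
    refine ⟨C * C₂, fun x r hr => (hC _ Metric.isOpen_ball).trans ?_⟩
    rw [psiAlpha_eq hα hp0 Ψ hr, ENNReal.coe_mul, mul_assoc]
    gcongr
    have h3 := h₁ x r hr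
    rw [← ENNReal.coe_mul] at h3
    rw [extendTop, if_neg (ne_top_of_le_ne_top ENNReal.coe_ne_top h3)]
    exact_mod_cast h₂ _ _
      ((ENNReal.toNNReal_mono ENNReal.coe_ne_top h3).trans_eq (ENNReal.toNNReal_coe _))
  · intro μ hμ
    obtain ⟨K, C, hK, h₁⟩ := measure_tent_le hn hα hαn hp hαp hΨ_incr hΨ_scale hΨ_int hμ
    have hK0 : 0 < K := one_pos.trans_le hK
    -- The factor 2 leaves room for a near-minimizer, since the infimum defining the capacity need
    -- not be attained.
    obtain ⟨C₂, -, h₂⟩ := exists_le_mul_of_le_mul hΨ_incr hΨ_scale (2 * K)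
    have main : ∀ O : Set (EuclideanSpace ℝ (Fin n)), IsOpen O → ∀ A : ℝ≥0, 0 < A →
        K * besselCap α p O < A → μ (tent O) ≤ C * Ψ A := by
      intro O hO A hA hlt
      have hlt' : besselCap α p O < A / K := by
        rwa [ENNReal.lt_div_iff_mul_lt (by simp [hK0.ne']) (by simp), mul_comm]
      obtain ⟨f, g, hfg, hf, hg⟩ := exists_isBesselPotential_of_besselCap_lt hp0 hlt'
      rw [ENNReal.lt_div_iff_mul_lt (by simp [hK0.ne']) (by simp), mul_comm] at hg
      exact h₁ O f g A hO hfg hf hA hg.le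
    -- Adding 1 keeps the constant nonzero, so that its product with `∞` is `∞` when the capacity is
    -- infinite.
    refine ⟨C * C₂ + 1, fun O hO => ?_⟩
    by_cases htop : besselCap α p O = ∞
    · rw [extendTop, if_pos htop, ENNReal.mul_top (by simp)]
      exact le_top
    rw [extendTop, if_neg htop]
    obtain ⟨c, hc⟩ : ∃ c : ℝ≥0, (c : ℝ≥0∞) = besselCap α p O :=
      ⟨_, ENNReal.coe_toNNReal htop⟩
    rw [← hc, ENNReal.toNNReal_coe]
    rw [← hc] at htop
    rcases eq_or_lt_of_le (zero_le : 0 ≤ c) with rfl | hc0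
    · have hzero : μ (tent O) ≤ 0 := by
        refine ENNReal.le_of_forall_pos_le_add fun ε hε _ => ?_
        -- For zero capacity every `A > 0` is admissible; surjectivity makes `Ψ(A)` as small as
        -- desired, and `Ψ(0) = 0` forces `A > 0`.
        obtain ⟨A, hA⟩ := hΨ_onto (ε / (C + 1))
        have hA0 : 0 < A := by
          rcases eq_or_lt_of_le (zero_le : 0 ≤ A) with rfl | h
          · rw [hΨ_zero] at hA
            exact absurd hA (ne_of_lt (by positivity))
          · exact h
        refine (main O hO A hA0 (by rw [← hc]; simpa using hA0)).trans ?_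
        rw [hA, zero_add, ← ENNReal.coe_mul, ENNReal.coe_le_coe, ← mul_div_assoc,
          div_le_iff₀ (by positivity), mul_comm]
        gcongr
        simp
      exact hzero.trans zero_le
    · have h3 : K * c < 2 * K * c := by
        rw [mul_assoc, two_mul]
        exact lt_add_of_pos_left _ (by positivity)
      refine (main O hO (2 * K * c) (by positivity) (by rw [← hc]; exact_mod_cast h3)).trans ?_
      calc (C : ℝ≥0∞) * Ψ (2 * K * c) ≤ C * (C₂ * Ψ c : ℝ≥0) := by
            gcongr; exact h₂ _ _ le_rfl
        _ = (C * C₂ : ℝ≥0) * Ψ c := by push_cast; ring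
        _ ≤ _ := by gcongr; simp
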